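/- Consider a single server of unit capacity and $K\ge 2$ classes of jobs. Class $i$ jobs arrive in a Poisson stream of rate $\lambda_i>0$, have exponential service requirements with mean $1/\mu$ (the same $\mu>0$ for all classes), and incur a cost $c_i>0$ per unit of time spent in the system. Let $\lambda=\sum_i\lambda_i$, $\rho_i=\lambda_i/\mu$ and $\rho=\sum_i\rho_i$, and assume $\rho<1$, $c_1\ge c_2\ge\dots\ge c_K$ and $c_1>c_K$. Let $\alpha>0$; a job that chooses priority level $\beta>0$ pays $\beta^\alpha$. For $\boldsymbol\beta=(\beta_1,\dots,\beta_K)$ with positive entries put $$V^{HT}(\beta;\boldsymbol\beta)=\frac1{1-\rho}\cdot\frac1{\mu\beta\gamma(\boldsymbol\beta)},\qquad \gamma(\boldsymbol\beta)=\frac1\rho\sum_{i=1}^K\frac{\rho_i}{\beta_i}.$$ A heavy traffic equilibrium (HTE) is a vector $\boldsymbol\beta^*$ with positive entries such that, for every $i$, $\beta_i^*$ minimises $c_iV^{HT}(\beta;\boldsymbol\beta^*)+\beta^\alpha$ over $\beta>0$; its processing cost is $\mathcal C=\sum_i\lambda_ic_iV^{HT}(\beta_i^*;\boldsymbol\beta^*)$.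 Let $\mathcal C^{opt}$ be the infimum of the steady-state expected processing cost per unit time, $\sum_ic_i\mathbf E[N_i]$, over all preemptive scheduling policies that divide the capacity among the classes according to the numbers $(N_1,\dots,N_K)$ of jobs present (idling allowed). There is exactly one HTE. The infimum $\mathcal C^{opt}$ is positive and is a minimum, and it is the cost of the $c\mu$-rule (never idle while jobs are present, and give strict preemptive priority to classes of larger $c_i$). The price of anarchy of the HTE satisfies $$\frac{\mathcal C}{\mathcal C^{opt}}<\frac{\sum_{i=1}^{K-1}\frac{\lambda_i}{\lambda_K}\left(\frac{c_i}{c_K}\right)^{\frac{\alpha}{\alpha+1}}+1}{\sum_{i=1}^{K-1}\frac{\lambda_i}{\lambda_K}\left(\frac{c_i}{c_K}\right)^{-\frac1{\alpha+1}}+1}<\frac{\lambda-\lambda_K}{\lambda_K}\left(\frac{c_1}{c_K}\right)^{\frac{\alpha}{\alpha+1}}+1 .$$ Moreover, fix $K\ge2$, $\alpha>0$, $c_K>0$ and a common arrival rate $\lambda_1=\dots=\lambda_K>0$, and for $m>1$ let $c_i=m\,c_K$ for $i<K$ and choose $\mu$ so that $\rho=1-m^{-2}$. Then, as $m\to\infty$,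 $\mathcal C/\mathcal C^{opt}\to\infty$, $\mathcal C/\mathcal C^{opt}=\Omega\big((K-1)m^{\alpha/(\alpha+1)}\big)$, and the ratio of $\mathcal C/\mathcal C^{opt}$ to each of the two upper bounds above tends to $1$. -/

import Mathlib

noncomputable section

/-- Data of a single-server queue of unit capacity with `K` classes of jobs: class `i` jobs arrive
in a Poisson stream of rate `lam i`, have exponential service requirements of mean `1 / mu`, and
cost `c i` per unit of time spent in the system. -/
structure JobSystem (K : ℕ) where
  /-- arrival rates -/
  lam : Fin K → ℝ
  /-- costs per unit time -/
  c : Fin K → ℝ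
  /-- common service rate -/
  mu : ℝ

/-- A preemptive scheduling policy. When there are `n i` jobs of class `i` in the system, class `i`
receives in total the fraction `alloc n i` of the service capacity. Idling and sharing of the
capacity are allowed. -/
structure SchedPolicy (K : ℕ) where
  /-- fraction of the capacity given to each class -/
  alloc : (Fin K → ℕ) → Fin K → ℝ
  alloc_nonneg : ∀ n i, 0 ≤ alloc n i
  alloc_sum_le_one : ∀ n, ∑ i, alloc n i ≤ 1
  alloc_empty : ∀ n i, n i = 0 → alloc n i = 0

namespace JobSystem

variable {K : ℕ}

/-- The load of class `i`. -/
def classLoad (S : JobSystem K) (i : Fin K) : ℝ := S.lam i / S.mu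

/-- The system load. -/
def load (S : JobSystem K) : ℝ := ∑ i, S.classLoad i

/-- The parameters are positive and the system load is less than one. -/
structure IsStable (S : JobSystem K) : Prop where
  lam_pos : ∀ i, 0 < S.lam i
  c_pos : ∀ i, 0 < S.c i
  mu_pos : 0 < S.mu
  load_lt_one : S.load < 1

/-! ### The heavy traffic equilibrium -/

/-- The load-weighted average of the inverse priority levels. -/
def gam (S : JobSystem K) (β : Fin K → ℝ) : ℝ :=
  1 / S.load * ∑ i, S.classLoad i / β i

/-- Heavy traffic processing time of a job of priority level `b` when all class `i` jobs choose
the priority level `β i`. -/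
def heavyTrafficTime (S : JobSystem K) (b : ℝ) (β : Fin K → ℝ) : ℝ :=
  1 / (1 - S.load) * (1 / (S.mu * b * S.gam β))

/-- `β` is a heavy traffic equilibrium under the pricing rule `b ↦ b ^ α`: each `β i` minimises the
heavy traffic processing cost plus the payment of a class `i` job over all `b > 0`. -/
def IsHTE (S : JobSystem K) (α : ℝ) (β : Fin K → ℝ) : Prop :=
  ∀ i, 0 < β i ∧
    IsMinOn (fun b : ℝ => S.c i * S.heavyTrafficTime b β + b ^ α) (Set.Ioi 0) (β i)

/-- The expected processing cost incurred by the system in one unit of time, according to the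
heavy traffic processing times, when class `i` jobs choose the priority level `β i`. -/
def processingCost (S : JobSystem K) (β : Fin K → ℝ) : ℝ :=
  ∑ i, S.lam i * S.c i * S.heavyTrafficTime (β i) β

/-! ### Steady states and the optimal processing cost -/

/-- `p` is a stationary distribution of the continuous-time Markov chain of the job counts under
the policy `P`, which jumps from `n` to `n + e_i` at rate `lam i` and from `n` to `n - e_i`
at rate `mu * P.alloc n i`: a probability distribution satisfying global balance. -/
structure IsSteadyState (S : JobSystem K) (P : SchedPolicy K) (p : (Fin K → ℕ) → ℝ) : Prop where
  nonneg : ∀ n, 0 ≤ p n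
  total : HasSum p 1
  balance : ∀ n,
    p n * (∑ i, S.lam i + ∑ i, S.mu * P.alloc n i) =
      (∑ i, if n i = 0 then 0 else p (n - Pi.single i 1) * S.lam i) +
        ∑ i, p (n + Pi.single i 1) * (S.mu * P.alloc (n + Pi.single i 1) i)

/-- The values of the expected processing cost incurred per unit time in steady state under the
policy `P`; in state `n` the system incurs cost at rate `∑ i, c i * n i`. -/
def policyCosts (S : JobSystem K) (P : SchedPolicy K) : Set ℝ :=
  {C | ∃ p, S.IsSteadyState P p ∧ HasSum (fun n : Fin K → ℕ => p n * ∑ i, S.c i * (n i : ℝ)) C}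

/-- The values of the expected processing cost attained by some policy in steady state. -/
def attainableCosts (S : JobSystem K) : Set ℝ := {C | ∃ P : SchedPolicy K, C ∈ S.policyCosts P}

/-- The optimal expected processing cost per unit time. -/
def optCost (S : JobSystem K) : ℝ := sInf S.attainableCosts

/-- `P` is a `cμ`-rule: it never idles while jobs are present, and a class gets no
service while a job of a class of strictly larger cost (all service rates being equal) is present.
Among classes of equal cost the service may be split in any way. -/
def IsCMuRule (S : JobSystem K) (P : SchedPolicy K) : Prop :=
  (∀ n : Fin K → ℕ, n ≠ 0 → ∑ i, P.alloc n i = 1) ∧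
    ∀ (n : Fin K → ℕ) (i j : Fin K), n i ≠ 0 → S.c j < S.c i → P.alloc n j = 0

/-! ### The bounds; here there are `k + 1` classes and `Fin.last k` is the last one -/

/-- The finer bound on the price of anarchy. -/
def fineBound {k : ℕ} (S : JobSystem (k + 1)) (α : ℝ) : ℝ :=
  (∑ i : Fin k, S.lam i.castSucc / S.lam (Fin.last k) *
      (S.c i.castSucc / S.c (Fin.last k)) ^ (α / (α + 1)) + 1) /
    (∑ i : Fin k, S.lam i.castSucc / S.lam (Fin.last k) *
      (S.c i.castSucc / S.c (Fin.last k)) ^ (-(1 / (α + 1))) + 1)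

/-- The coarser bound on the price of anarchy. -/
def coarseBound {k : ℕ} (S : JobSystem (k + 1)) (α : ℝ) : ℝ :=
  (∑ i, S.lam i - S.lam (Fin.last k)) / S.lam (Fin.last k) *
    (S.c 0 / S.c (Fin.last k)) ^ (α / (α + 1)) + 1

/-- The system with `k + 1` classes with equal arrival rates `l`, costs `m * d` for all classes but
the last, cost `d` for the last class, and `mu` chosen to make the load `1 - 1 / m ^ 2`. -/
def tightSystem (k : ℕ) (l d m : ℝ) : JobSystem (k + 1) where
  lam := fun _ => l
  c := fun i => if i = Fin.last k then d else m * d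
  mu := ((k : ℝ) + 1) * l / (1 - 1 / m ^ 2)

end JobSystem

end

noncomputable section

namespace JobSystem

open Finset Filter Topology

variable {K : ℕ}

/-! Optimal cost. For decreasing costs, Abel summation writes `∑ c i * n i` as a nonnegative
combination of the numbers of jobs in the top classes `Iic r`. Under any policy, balancing the flow
across the level `m` of the count of a set `A` of classes (`IsSteadyState.cut`) shows that this
count decays no faster than in an M/M/1 queue of load `ρ_A`; hence its mean is at least `ρ_A / (1 -
ρ_A)`, with equality if `A` has priority. The `cμ`-rule attains all the relevant bounds at once, so
its cost `priorityCost` is optimal.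

That a non-idling policy has a steady state (`exists_isSteadyState`) is proved by averaging the
uniformised chain. Started with a geometric total number of jobs, the chain keeps that law of the
total at every step, so no mass escapes in the limit.

Equilibrium. A class `i` job minimises `A / b + b ^ α` with `A` proportional to `c i`, so `β i` is
proportional to `c i ^ (1 / (α + 1))`, and the first-order condition fixes the common factor
(`isHTE_iff`). The equilibrium cost is exactly `c_K * ρ / (1 - ρ)` times the fine bound. The strict
bound is thus the inequality `c_K * ρ / (1 - ρ) < C^opt` (`lt_priorityCost`), which holds because
some cost gap before the last class is positive.

Tightness. With load `1 - m⁻²` the last class contributes `d * (m ^ 2 - 1)` to the optimal cost and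
all other terms only `O(m)`, so this inequality is asymptotically an equality. -/

/-- The number of jobs in state `n` whose class lies in `A`. -/
def groupCount (A : Finset (Fin K)) (n : Fin K → ℕ) : ℕ := ∑ i ∈ A, n i

/-! ### Generator, cut equations and mean numbers of jobs -/

lemma groupCount_add_single (A : Finset (Fin K)) (n : Fin K → ℕ) (i : Fin K) :
    groupCount A (n + Pi.single i 1) = groupCount A n + if i ∈ A then 1 else 0 := by
  simp [groupCount, sum_add_distrib]

lemma sub_single_add_single {n : Fin K → ℕ} {i : Fin K} (h : n i ≠ 0) :
    n - Pi.single i 1 + Pi.single i 1 = n := by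
  funext j
  rcases eq_or_ne j i with rfl | hj
  · simp; omega
  · simp [hj]

lemma groupCount_sub_single (A : Finset (Fin K)) {n : Fin K → ℕ} {i : Fin K} (h : n i ≠ 0) :
    groupCount A n = groupCount A (n - Pi.single i 1) + if i ∈ A then 1 else 0 := by
  rw [← groupCount_add_single, sub_single_add_single h]

lemma groupCount_eq_zero_iff {A : Finset (Fin K)} {n : Fin K → ℕ} :
    groupCount A n = 0 ↔ ∀ i ∈ A, n i = 0 := by
  simp [groupCount]

/-- The total rate of probability flow into the state `n`. -/
def inflow (S : JobSystem K) (P : SchedPolicy K) (p : (Fin K → ℕ) → ℝ) (n : Fin K → ℕ) : ℝ :=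
  (∑ i, if n i = 0 then 0 else p (n - Pi.single i 1) * S.lam i) +
    ∑ i, p (n + Pi.single i 1) * (S.mu * P.alloc (n + Pi.single i 1) i)

/-- The generator of the Markov chain of job counts, applied to a test function `h`. -/
def generator (S : JobSystem K) (P : SchedPolicy K) (h : (Fin K → ℕ) → ℝ) (n : Fin K → ℕ) : ℝ :=
  ∑ i, S.lam i * (h (n + Pi.single i 1) - h n) +
    ∑ i, S.mu * P.alloc n i * (h (n - Pi.single i 1) - h n)

lemma alloc_le_one (P : SchedPolicy K) (n : Fin K → ℕ) (i : Fin K) :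
    P.alloc n i ≤ 1 :=
  (single_le_sum (fun j _ => P.alloc_nonneg n j) (mem_univ i)).trans (P.alloc_sum_le_one n)

lemma add_single_injective (i : Fin K) :
    Function.Injective fun n : Fin K → ℕ => n + Pi.single i 1 :=
  add_left_injective _

lemma hasSum_shift_up {g : (Fin K → ℕ) → ℝ} {a : ℝ} (hg : HasSum g a) (i : Fin K) :
    HasSum (fun n : Fin K → ℕ => if n i = 0 then 0 else g (n - Pi.single i 1)) a := by
  rw [← (add_single_injective i).hasSum_iff]
  · convert hg using 1
    funext n
    simp
  · intro n hn
    rw [if_pos]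
    by_contra h
    exact hn ⟨n - Pi.single i 1, sub_single_add_single h⟩

/-- The shift `n ↦ n + e_i` misses exactly the states without class `i` jobs, so `g` must vanish
there. For service flows this is `alloc_empty`. -/
lemma hasSum_shift_down {g : (Fin K → ℕ) → ℝ} {a : ℝ} (hg : HasSum g a) {i : Fin K}
    (h0 : ∀ n, n i = 0 → g n = 0) : HasSum (fun n : Fin K → ℕ => g (n + Pi.single i 1)) a := by
  refine ((add_single_injective i).hasSum_iff ?_).2 hg
  intro n hn
  by_contra h
  exact hn ⟨n - Pi.single i 1, sub_single_add_single fun h' => h (h0 n h')⟩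

lemma summable_mul_of_abs_le {p w : (Fin K → ℕ) → ℝ} (hp : Summable p) {B : ℝ}
    (hw : ∀ n, |w n| ≤ B) : Summable fun n => p n * w n := by
  refine Summable.of_norm_bounded (g := fun n => |p n| * B) (hp.abs.mul_right B) fun n => ?_
  rw [Real.norm_eq_abs, abs_mul]
  exact mul_le_mul_of_nonneg_left (hw n) (abs_nonneg _)

/-- The flow into the states, tested against a bounded function, in terms of the generator. -/
lemma hasSum_netflow_mul (S : JobSystem K) (P : SchedPolicy K) {p h : (Fin K → ℕ) → ℝ}
    (hp : Summable p) {B : ℝ} (hB : ∀ n, |h n| ≤ B) :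
    HasSum (fun n => (S.inflow P p n -
      p n * (∑ i, S.lam i + ∑ i, S.mu * P.alloc n i)) * h n)
      (∑' n, p n * S.generator P h n) := by
  have ha : ∀ n i, |P.alloc n i| ≤ 1 := fun n i => by
    rw [abs_of_nonneg (P.alloc_nonneg n i)]; exact alloc_le_one P n i
  have hB0 : 0 ≤ B := (abs_nonneg _).trans (hB 0)
  have h1 : ∀ i, Summable fun n => p n * (S.lam i * h (n + Pi.single i 1)) := fun i =>
    summable_mul_of_abs_le hp (B := |S.lam i| * B) fun n => by
      rw [abs_mul]; exact mul_le_mul_of_nonneg_left (hB _) (abs_nonneg _)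
  have hal : ∀ n i (x : ℝ), |x| ≤ B → |S.mu * P.alloc n i * x| ≤ |S.mu| * 1 * B := by
    intro n i x hx
    rw [abs_mul, abs_mul]
    gcongr
    exact ha n i
  have h2 : ∀ i, Summable fun n => p n * (S.mu * P.alloc n i * h (n - Pi.single i 1)) := fun i =>
    summable_mul_of_abs_le hp fun n => hal n i _ (hB _)
  have h3 : ∀ i, Summable fun n => p n * (S.lam i * h n) := fun i =>
    summable_mul_of_abs_le hp (B := |S.lam i| * B) fun n => by
      rw [abs_mul]; exact mul_le_mul_of_nonneg_left (hB _) (abs_nonneg _)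
  have h4 : ∀ i, Summable fun n => p n * (S.mu * P.alloc n i * h n) := fun i =>
    summable_mul_of_abs_le hp fun n => hal n i _ (hB _)
  have key : HasSum (fun n => p n * S.generator P h n)
      ((∑ i, ∑' n, p n * (S.lam i * h (n + Pi.single i 1))
        + ∑ i, ∑' n, p n * (S.mu * P.alloc n i * h (n - Pi.single i 1)))
        - (∑ i, ∑' n, p n * (S.lam i * h n) + ∑ i, ∑' n, p n * (S.mu * P.alloc n i * h n))) := by
    have := ((hasSum_sum fun i (_ : i ∈ univ) => (h1 i).hasSum).add
      (hasSum_sum fun i (_ : i ∈ univ) => (h2 i).hasSum)).sub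
      ((hasSum_sum fun i (_ : i ∈ univ) => (h3 i).hasSum).add
      (hasSum_sum fun i (_ : i ∈ univ) => (h4 i).hasSum))
    refine (congrArg (HasSum · _) (funext fun n => ?_)).mpr this
    simp only [generator, mul_sub, sum_sub_distrib, mul_add, mul_sum]
    ring
  rw [key.tsum_eq]
  -- The arrival and service terms are reindexed by opposite shifts, which turns jumps out of `n`
  -- into jumps into `n`.
  have := ((hasSum_sum fun i (_ : i ∈ univ) => hasSum_shift_up (h1 i).hasSum i).add
      (hasSum_sum fun i (_ : i ∈ univ) => hasSum_shift_down (i := i) (h2 i).hasSum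
        (fun n hn => by simp [P.alloc_empty n i hn]))).sub
      ((hasSum_sum fun i (_ : i ∈ univ) => (h3 i).hasSum).add
      (hasSum_sum fun i (_ : i ∈ univ) => (h4 i).hasSum))
  refine (congrArg (HasSum · _) (funext fun n => ?_)).mpr this
  simp only [inflow, sub_mul, add_mul, mul_add, sum_mul, mul_sum]
  congr 1
  · congr 1
    · refine sum_congr rfl fun i _ => ?_
      split_ifs with h0
      · simp
      · rw [sub_single_add_single h0]; ring
    · refine sum_congr rfl fun i _ => ?_
      simp; ring
  · congr 1
    · exact sum_congr rfl fun i _ => by ring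
    · exact sum_congr rfl fun i _ => by ring

/-- The generator applied to the indicator of `{groupCount A ≤ m}`. -/
lemma generator_indicator (S : JobSystem K) (P : SchedPolicy K) (A : Finset (Fin K)) (m : ℕ)
    (n : Fin K → ℕ) :
    S.generator P (fun n => if groupCount A n ≤ m then 1 else 0) n =
      (if groupCount A n = m + 1 then S.mu * ∑ i ∈ A, P.alloc n i else 0) -
        (if groupCount A n = m then ∑ i ∈ A, S.lam i else 0) := by
  -- Only jumps across the cut contribute: arrivals to `A` from level `m` and departures from `A` at
  -- level `m + 1`.
  have h1 : ∀ i, S.lam i * ((if groupCount A (n + Pi.single i 1) ≤ m then (1 : ℝ) else 0) -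
      if groupCount A n ≤ m then 1 else 0) =
      if i ∈ A then (if groupCount A n = m then - S.lam i else 0) else 0 := by
    intro i
    rw [groupCount_add_single]
    split_ifs <;> first | omega | simp
  have h2 : ∀ i, S.mu * P.alloc n i *
      ((if groupCount A (n - Pi.single i 1) ≤ m then (1 : ℝ) else 0) -
      if groupCount A n ≤ m then 1 else 0) =
      if i ∈ A then (if groupCount A n = m + 1 then S.mu * P.alloc n i else 0) else 0 := by
    intro i
    -- Here the truncated subtraction leaves `n` unchanged, but the class receives no service
    -- either.
    by_cases h0 : n i = 0
    · simp [P.alloc_empty n i h0]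
    · have := groupCount_sub_single A h0
      split_ifs at * <;> first | omega | simp
  simp only [generator, h1, h2, sum_ite_mem, univ_inter]
  split_ifs <;> (simp [mul_sum]; try ring)

/-- The cut equation between the states with at most `m` and those with more than `m` jobs of the
classes in `A`. -/
lemma IsSteadyState.cut {S : JobSystem K} {P : SchedPolicy K} {p : (Fin K → ℕ) → ℝ}
    (hp : S.IsSteadyState P p) (A : Finset (Fin K)) (m : ℕ) :
    ∑' n, p n * (if groupCount A n = m + 1 then S.mu * ∑ i ∈ A, P.alloc n i else 0) =
      ∑' n, p n * (if groupCount A n = m then ∑ i ∈ A, S.lam i else 0) := by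
  have hB : ∀ n, |(if groupCount A n ≤ m then (1 : ℝ) else 0)| ≤ 1 := fun n => by
    split_ifs <;> simp
  have h := (hasSum_netflow_mul S P hp.total.summable hB).tsum_eq
  have h0 : ∀ n, S.inflow P p n - p n * (∑ i, S.lam i + ∑ i, S.mu * P.alloc n i) = 0 := fun n => by
    rw [hp.balance n, inflow, sub_self]
  simp only [h0, zero_mul, tsum_zero, generator_indicator, mul_sub] at h
  rw [Summable.tsum_sub] at h
  · linarith
  · refine summable_mul_of_abs_le hp.total.summable (B := |S.mu|) fun n => ?_
    have h1 : 0 ≤ ∑ i ∈ A, P.alloc n i := sum_nonneg fun i _ => P.alloc_nonneg n i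
    have h2 : ∑ i ∈ A, P.alloc n i ≤ 1 :=
      (sum_le_univ_sum_of_nonneg (P.alloc_nonneg n)).trans (P.alloc_sum_le_one n)
    split_ifs
    · rw [abs_mul, abs_of_nonneg h1]
      exact mul_le_of_le_one_right (abs_nonneg _) h2
    · simp
  · refine summable_mul_of_abs_le hp.total.summable (B := |∑ i ∈ A, S.lam i|) fun n => ?_
    split_ifs <;> simp
/-- Expectations of functions of the number of jobs in `A`, by conditioning on that number. -/
lemma hasSum_groupCount_fibers {p : (Fin K → ℕ) → ℝ} (A : Finset (Fin K)) {w : ℕ → ℝ} {a : ℝ}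
    (h : HasSum (fun n => p n * w (groupCount A n)) a) :
    HasSum (fun m => w m * ∑' n, p n * (if groupCount A n = m then 1 else 0)) a := by
  refine (congrArg (HasSum · _) (funext fun m => ?_)).mpr (h.tsum_fiberwise (groupCount A))
  rw [tsum_subtype (groupCount A ⁻¹' {m}) (fun n => p n * w (groupCount A n)), ← tsum_mul_left]
  refine tsum_congr fun n => ?_
  by_cases hn : groupCount A n = m
  · rw [Set.indicator_of_mem (by simpa using hn), if_pos hn, hn]; ring
  · rw [Set.indicator_of_notMem (by simpa using hn), if_neg hn]; ring

lemma sum_alloc_le_one (P : SchedPolicy K) (A : Finset (Fin K)) (n : Fin K → ℕ) :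
    ∑ i ∈ A, P.alloc n i ≤ 1 :=
  (sum_le_univ_sum_of_nonneg (P.alloc_nonneg n)).trans (P.alloc_sum_le_one n)

/-- The distribution of the number of jobs in `A` decreases at most at the rate of the `M/M/1`
queue, and exactly at this rate if the classes in `A` have priority. -/
lemma IsSteadyState.levels {S : JobSystem K} {P : SchedPolicy K} {p : (Fin K → ℕ) → ℝ}
    (hp : S.IsSteadyState P p) (hmu : 0 < S.mu) (A : Finset (Fin K)) (m : ℕ) :
    (∑ i ∈ A, S.lam i) * (∑' n, p n * (if groupCount A n = m then 1 else 0)) ≤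
      S.mu * (∑' n, p n * (if groupCount A n = m + 1 then 1 else 0)) ∧
    ((∀ n, groupCount A n ≠ 0 → ∑ i ∈ A, P.alloc n i = 1) →
      (∑ i ∈ A, S.lam i) * (∑' n, p n * (if groupCount A n = m then 1 else 0)) =
      S.mu * (∑' n, p n * (if groupCount A n = m + 1 then 1 else 0))) := by
  have h1 : (∑ i ∈ A, S.lam i) * (∑' n, p n * (if groupCount A n = m then 1 else 0)) =
      ∑' n, p n * (if groupCount A n = m + 1 then S.mu * ∑ i ∈ A, P.alloc n i else 0) := by
    rw [hp.cut A m, ← tsum_mul_left]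
    refine tsum_congr fun n => ?_
    split_ifs <;> ring
  rw [h1, ← tsum_mul_left]
  have h0 : ∀ n, 0 ≤ ∑ i ∈ A, P.alloc n i := fun n => sum_nonneg fun i _ => P.alloc_nonneg n i
  refine ⟨Summable.tsum_le_tsum (fun n => ?_) ?_ ?_, fun h => tsum_congr fun n => ?_⟩
  · split_ifs
    · rw [mul_one, mul_comm S.mu (p n)]
      exact mul_le_mul_of_nonneg_left
        (mul_le_of_le_one_right hmu.le (sum_alloc_le_one P A n)) (hp.nonneg n)
    · simp
  · refine summable_mul_of_abs_le hp.total.summable (B := S.mu) fun n => ?_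
    split_ifs
    · rw [abs_of_nonneg (mul_nonneg hmu.le (h0 n))]
      exact mul_le_of_le_one_right hmu.le (sum_alloc_le_one P A n)
    · simpa using hmu.le
  · refine (summable_mul_of_abs_le hp.total.summable (B := 1) fun n => ?_).mul_left _
    split_ifs <;> simp
  · split_ifs with hn
    · rw [h n (by omega)]; ring
    · ring

/-- The mean number of jobs of the classes in `A` is at least that in the `M/M/1` queue formed by
these classes alone, with equality if they have priority. -/
lemma IsSteadyState.mean_groupCount {S : JobSystem K} {P : SchedPolicy K} {p : (Fin K → ℕ) → ℝ}
    (hp : S.IsSteadyState P p) (hmu : 0 < S.mu) (A : Finset (Fin K))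
    {E : ℝ} (hE : HasSum (fun n => p n * (groupCount A n : ℝ)) E) :
    (∑ i ∈ A, S.lam i) * (E + 1) ≤ S.mu * E ∧
    ((∀ n, groupCount A n ≠ 0 → ∑ i ∈ A, P.alloc n i = 1) →
      (∑ i ∈ A, S.lam i) * (E + 1) = S.mu * E) := by
  set q : ℕ → ℝ := fun m => ∑' n, p n * (if groupCount A n = m then 1 else 0) with hq
  have hq0 : ∀ m, 0 ≤ q m := fun m => tsum_nonneg fun n =>
    mul_nonneg (hp.nonneg n) (by split_ifs <;> simp)
  have h1 : HasSum (fun m : ℕ => (m : ℝ) * q m) E := hasSum_groupCount_fibers A (w := fun m => m) hE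
  have h2 : HasSum (fun m : ℕ => ((m : ℝ) + 1) * q m) (E + 1) := by
    have := hasSum_groupCount_fibers A (w := fun _ => 1) (by simpa using hp.total)
    refine (congrArg (HasSum · _) (funext fun n => ?_)).mpr (h1.add this)
    simp only [hq]; ring
  -- The term `m = 0` of the mean vanishes. After the shift, `E` and `E + 1` carry the same weights
  -- `m + 1`, so `levels` compares them term by term.
  have h3 : HasSum (fun m : ℕ => ((m : ℝ) + 1) * q (m + 1)) E := by
    have := (hasSum_nat_add_iff' 1).2 h1
    simpa using this
  have h4 := h2.mul_left (∑ i ∈ A, S.lam i)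
  have h5 := h3.mul_left S.mu
  refine ⟨hasSum_le (fun m => ?_) h4 h5, fun h => h4.unique ?_⟩
  · have := (hp.levels hmu A m).1
    nlinarith
  · refine (congrArg (HasSum · _) (funext fun m => ?_)).mpr h5
    have := (hp.levels hmu A m).2 h
    simp only [hq]
    linear_combination ((m : ℝ) + 1) * this
-- Existence of a steady state for non-idling policies
/-- The states with at most `m` jobs. -/
def ball (K m : ℕ) : Finset (Fin K → ℕ) :=
  (Fintype.piFinset fun _ => range (m + 1)).filter fun n => groupCount univ n ≤ m

lemma mem_ball {m : ℕ} {n : Fin K → ℕ} : n ∈ ball K m ↔ groupCount univ n ≤ m := by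
  simp only [ball, mem_filter, Fintype.mem_piFinset, mem_range, and_iff_right_iff_imp]
  intro h i
  have : n i ≤ ∑ j, n j := single_le_sum (fun j _ => Nat.zero_le (n j)) (mem_univ i)
  simp only [groupCount] at h
  omega

lemma ball_mono : Monotone (ball K) := fun _ _ h n hn => by
  rw [mem_ball] at *; omega

lemma tendsto_ball : Tendsto (ball K) atTop atTop :=
  tendsto_atTop_finset_of_monotone ball_mono fun n => ⟨groupCount univ n, mem_ball.2 le_rfl⟩

lemma sum_ball_succ (f : (Fin K → ℕ) → ℝ) (m : ℕ) :
    ∑ n ∈ ball K (m + 1), f n =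
      ∑ n ∈ ball K m, f n + ∑ n ∈ ball K (m + 1), if groupCount univ n = m + 1 then f n else 0 := by
  have : ∑ n ∈ ball K m, f n =
      ∑ n ∈ ball K (m + 1), if groupCount univ n ≤ m then f n else 0 := by
    rw [← sum_filter]
    refine sum_congr ?_ fun _ _ => rfl
    ext n
    simp only [mem_filter, mem_ball]
    omega
  rw [this, ← sum_add_distrib]
  refine sum_congr rfl fun n hn => ?_
  rw [mem_ball] at hn
  split_ifs <;> first | omega | simp

/-- Under `p` the total number of jobs has the geometric distribution with parameter `r`. -/
structure IsGeometric (r : ℝ) (p : (Fin K → ℕ) → ℝ) : Prop where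
  nonneg : ∀ n, 0 ≤ p n
  sum_ball : ∀ m, ∑ n ∈ ball K m, p n = 1 - r ^ (m + 1)

namespace IsGeometric

variable {r : ℝ} {p : (Fin K → ℕ) → ℝ}

lemma hasSum_one (h : IsGeometric r p) (h0 : 0 ≤ r) (h1 : r < 1) : HasSum p 1 := by
  have hs : Summable p := summable_of_sum_le h.nonneg (c := 1) fun u => by
    obtain ⟨m, hm⟩ := (tendsto_ball.eventually (eventually_ge_atTop u)).exists
    calc ∑ n ∈ u, p n ≤ ∑ n ∈ ball K m, p n :=
          sum_le_sum_of_subset_of_nonneg hm fun n _ _ => h.nonneg n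
      _ ≤ 1 := by rw [h.sum_ball]; linarith [pow_nonneg h0 (m + 1)]
  have ht : Tendsto (fun m => ∑ n ∈ ball K m, p n) atTop (𝓝 1) := by
    simp only [h.sum_ball]
    simpa using ((tendsto_pow_atTop_nhds_zero_of_lt_one h0 h1).comp
      (tendsto_add_atTop_nat 1)).const_sub 1
  have := tendsto_nhds_unique (hs.hasSum.comp tendsto_ball) ht
  exact this ▸ hs.hasSum

lemma le_one (h : IsGeometric r p) (h0 : 0 ≤ r) (h1 : r < 1) (n : Fin K → ℕ) : p n ≤ 1 :=
  le_hasSum (h.hasSum_one h0 h1) n fun j _ => h.nonneg j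

lemma sum_level (h : IsGeometric r p) (m : ℕ) :
    ∑ n ∈ ball K m, (if groupCount univ n = m then p n else 0) = r ^ m - r ^ (m + 1) := by
  cases m with
  | zero =>
    rw [pow_zero, ← h.sum_ball]
    refine sum_congr rfl fun n hn => if_pos ?_
    rw [mem_ball] at hn
    omega
  | succ m =>
    have := sum_ball_succ p m
    rw [h.sum_ball, h.sum_ball] at this
    linarith

lemma tsum_level (h : IsGeometric r p) (m : ℕ) :
    ∑' n, p n * (if groupCount univ n = m then 1 else 0) = r ^ m - r ^ (m + 1) := by
  rw [← h.sum_level, tsum_eq_sum (s := ball K m)]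
  · exact sum_congr rfl fun n _ => by split_ifs <;> simp
  · intro n hn
    rw [mem_ball] at hn
    rw [if_neg (by omega), mul_zero]

/-- Over a ball the sum is a partial sum of the series for the mean of the geometric law. A finite
mean therefore follows from `IsGeometric` alone and needs no separate passage to the limit. -/
lemma summable_mul_groupCount (h : IsGeometric r p) (h0 : 0 ≤ r) (h1 : r < 1) :
    Summable fun n => p n * (groupCount univ n : ℝ) := by
  have hs : Summable fun m : ℕ => (m : ℝ) * (r ^ m - r ^ (m + 1)) := by
    have := (summable_pow_mul_geometric_of_norm_lt_one 1
      (by rwa [Real.norm_of_nonneg h0] : ‖r‖ < 1)).mul_right (1 - r)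
    refine this.congr fun m => ?_
    ring
  have hnn : ∀ m : ℕ, 0 ≤ (m : ℝ) * (r ^ m - r ^ (m + 1)) := fun m =>
    mul_nonneg m.cast_nonneg (sub_nonneg.2 (pow_le_pow_of_le_one h0 h1.le m.le_succ))
  have key : ∀ m, ∑ n ∈ ball K m, p n * (groupCount univ n : ℝ) =
      ∑ j ∈ range (m + 1), (j : ℝ) * (r ^ j - r ^ (j + 1)) := by
    intro m
    induction m with
    | zero =>
      simp only [zero_add, range_one, sum_singleton, Nat.cast_zero, zero_mul]
      refine sum_eq_zero fun n hn => ?_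
      rw [mem_ball, Nat.le_zero] at hn
      simp [hn]
    | succ m ih =>
      rw [sum_ball_succ, ih, sum_range_succ _ (m + 1), ← h.sum_level, mul_sum]
      congr 1
      refine sum_congr rfl fun n _ => ?_
      split_ifs with hn
      · rw [hn]; ring
      · simp
  refine summable_of_sum_le (fun n => mul_nonneg (h.nonneg n) (Nat.cast_nonneg _))
    (c := ∑' m : ℕ, (m : ℝ) * (r ^ m - r ^ (m + 1))) fun u => ?_
  obtain ⟨m, hm⟩ := (tendsto_ball.eventually (eventually_ge_atTop u)).exists
  calc _ ≤ ∑ n ∈ ball K m, p n * (groupCount univ n : ℝ) :=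
        sum_le_sum_of_subset_of_nonneg hm fun n _ _ =>
          mul_nonneg (h.nonneg n) (Nat.cast_nonneg _)
    _ ≤ _ := by rw [key]; exact hs.sum_le_tsum _ fun j _ => hnn j

end IsGeometric

/-- Only the total is prescribed, so all jobs may be put into class `0`. -/
lemma exists_isGeometric [NeZero K] {r : ℝ} (h0 : 0 ≤ r) (h1 : r < 1) :
    ∃ p : (Fin K → ℕ) → ℝ, IsGeometric r p := by
  refine ⟨fun n => if n = Pi.single 0 (n 0) then r ^ (n 0) * (1 - r) else 0, fun n => ?_,
    fun m => ?_⟩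
  · have : 0 ≤ 1 - r := by linarith
    split_ifs <;> positivity
  · have h2 : ∑ j ∈ range (m + 1), r ^ j * (1 - r) = 1 - r ^ (m + 1) := by
      rw [← sum_mul, geom_sum_mul_neg]
    rw [← h2]
    symm
    refine sum_of_injOn (fun j => Pi.single 0 j) (Pi.single_injective (M := fun _ : Fin K => ℕ) 0).injOn ?_ ?_ ?_
    · intro j hj
      simp only [coe_range, Set.mem_Iio] at hj
      simp only [mem_coe, mem_ball, groupCount, sum_pi_single']
      simp; omega
    · intro n hn hn'
      refine if_neg fun h => hn' ⟨n 0, ?_, h.symm⟩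
      rw [mem_ball] at hn
      have : n 0 ≤ ∑ j, n j := single_le_sum (fun j _ => Nat.zero_le (n j)) (mem_univ 0)
      simp only [groupCount] at hn
      simp; omega
    · intro j _
      simp

/-- The difference of the flows into and out of the states, as a linear map. -/
def netflow (S : JobSystem K) (P : SchedPolicy K) :
    ((Fin K → ℕ) → ℝ) →ₗ[ℝ] ((Fin K → ℕ) → ℝ) where
  toFun p n := S.inflow P p n - p n * (∑ i, S.lam i + ∑ i, S.mu * P.alloc n i)
  map_add' p q := by
    funext n
    have : ∀ i, (if n i = 0 then 0 else (p + q) (n - Pi.single i 1) * S.lam i) =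
        (if n i = 0 then 0 else p (n - Pi.single i 1) * S.lam i) +
        (if n i = 0 then 0 else q (n - Pi.single i 1) * S.lam i) := fun i => by
      split_ifs <;> simp [add_mul]
    simp only [inflow, this]
    simp only [Pi.add_apply, add_mul, sum_add_distrib]
    ring
  map_smul' a p := by
    funext n
    have : ∀ i, (if n i = 0 then 0 else (a • p) (n - Pi.single i 1) * S.lam i) =
        a * (if n i = 0 then 0 else p (n - Pi.single i 1) * S.lam i) := fun i => by
      split_ifs <;> simp [mul_assoc]
    simp only [inflow, this]
    simp only [Pi.smul_apply, smul_eq_mul, RingHom.id_apply, mul_assoc, ← mul_sum]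
    ring

lemma netflow_apply (S : JobSystem K) (P : SchedPolicy K) (p : (Fin K → ℕ) → ℝ) (n : Fin K → ℕ) :
    S.netflow P p n = S.inflow P p n - p n * (∑ i, S.lam i + ∑ i, S.mu * P.alloc n i) := rfl

/-- In the product topology this holds because the flow at `n` involves only finitely many
coordinates of `p`. -/
lemma continuous_netflow (S : JobSystem K) (P : SchedPolicy K) (n : Fin K → ℕ) :
    Continuous fun p => S.netflow P p n := by
  simp only [netflow_apply, inflow]
  refine ((continuous_finsetSum _ fun i _ => ?_).add (by fun_prop)).sub (by fun_prop)
  split_ifs <;> fun_prop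

lemma IsStable.sum_lam [NeZero K] {S : JobSystem K} (hS : S.IsStable) :
    ∑ i, S.lam i = S.mu * S.load := by
  have := hS.mu_pos.ne'
  simp only [load, classLoad, mul_sum]
  exact sum_congr rfl fun i _ => by field_simp

lemma IsStable.load_pos [NeZero K] {S : JobSystem K} (hS : S.IsStable) : 0 < S.load :=
  sum_pos (fun i _ => div_pos (hS.lam_pos i) hS.mu_pos) univ_nonempty

/-- One step of the uniformised chain. -/
def uniformStep (S : JobSystem K) (P : SchedPolicy K) (p : (Fin K → ℕ) → ℝ) : (Fin K → ℕ) → ℝ :=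
  p + (∑ i, S.lam i + S.mu)⁻¹ • S.netflow P p

/-- Without idling, a step of the uniformised chain preserves the geometric distribution of the
total number of jobs. -/
lemma IsGeometric.uniformStep [NeZero K] {S : JobSystem K} (hS : S.IsStable) {P : SchedPolicy K}
    (hP : ∀ n, n ≠ 0 → ∑ i, P.alloc n i = 1) {p : (Fin K → ℕ) → ℝ}
    (hp : IsGeometric S.load p) : IsGeometric S.load (S.uniformStep P p) := by
  have hlam : 0 < ∑ i, S.lam i := sum_pos (fun i _ => hS.lam_pos i) univ_nonempty
  have hL : 0 < ∑ i, S.lam i + S.mu := add_pos hlam hS.mu_pos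
  refine ⟨fun n => ?_, fun m => ?_⟩
  · have hin : 0 ≤ S.inflow P p n := by
      refine add_nonneg (sum_nonneg fun i _ => ?_) (sum_nonneg fun i _ => ?_)
      · split_ifs
        · exact le_rfl
        · exact mul_nonneg (hp.nonneg _) (hS.lam_pos i).le
      · exact mul_nonneg (hp.nonneg _) (mul_nonneg hS.mu_pos.le (P.alloc_nonneg _ _))
    -- The uniformisation rate dominates the outflow rate of every state, so a step keeps the
    -- weights nonnegative.
    have hout : ∑ i, S.lam i + ∑ i, S.mu * P.alloc n i ≤ ∑ i, S.lam i + S.mu := by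
      rw [← mul_sum]
      have := mul_le_of_le_one_right hS.mu_pos.le (P.alloc_sum_le_one n)
      linarith
    have h2 := mul_le_mul_of_nonneg_left hout (hp.nonneg n)
    have : S.uniformStep P p n = (∑ i, S.lam i + S.mu)⁻¹ * (p n * (∑ i, S.lam i + S.mu) +
        (S.inflow P p n - p n * (∑ i, S.lam i + ∑ i, S.mu * P.alloc n i))) := by
      simp only [JobSystem.uniformStep, Pi.add_apply, Pi.smul_apply, smul_eq_mul, netflow_apply]
      field_simp
    rw [this]
    exact mul_nonneg (inv_nonneg.2 hL.le) (by linarith)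
  · have hsum := hp.hasSum_one hS.load_pos.le hS.load_lt_one
    have hB : ∀ n : Fin K → ℕ, |(if groupCount univ n ≤ m then (1 : ℝ) else 0)| ≤ 1 := fun n => by
      split_ifs <;> simp
    have h := (hasSum_netflow_mul S P hsum.summable hB).tsum_eq
    rw [tsum_eq_sum (s := ball K m) (fun n hn => by
      rw [mem_ball] at hn; rw [if_neg hn, mul_zero])] at h
    have h1 : ∀ n, p n * S.generator P (fun n => if groupCount univ n ≤ m then 1 else 0) n =
        S.mu * (p n * (if groupCount univ n = m + 1 then 1 else 0)) -
        (S.mu * S.load) * (p n * (if groupCount univ n = m then 1 else 0)) := fun n => by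
      have h0 : groupCount univ n = m + 1 → ∑ i, P.alloc n i = 1 := fun h2 => hP n <| by
        rintro rfl
        simp [groupCount] at h2
      rw [generator_indicator, hS.sum_lam]
      split_ifs with h2 <;> first | (rw [h0 h2]; ring) | ring
    have hs : ∀ m, Summable fun n => p n * (if groupCount univ n = m then 1 else 0) := fun m =>
      summable_mul_of_abs_le hsum.summable (B := 1) fun n => by split_ifs <;> simp
    simp only [h1] at h
    rw [Summable.tsum_sub ((hs _).mul_left _) ((hs _).mul_left _), tsum_mul_left, tsum_mul_left,
      hp.tsum_level, hp.tsum_level] at h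
    -- The flow down from level `m + 1`, `μ (ρ^(m+1) - ρ^(m+2))`, equals the flow up from level `m`,
    -- `μ ρ (ρ^m - ρ^(m+1))`, so the mass of the ball does not change.
    have h3 : ∑ n ∈ ball K m, S.netflow P p n = 0 := by
      have : ∑ n ∈ ball K m, S.netflow P p n = _ :=
        (sum_congr rfl fun n hn => by
          rw [netflow_apply, if_pos (mem_ball.1 hn), mul_one]).trans h
      rw [this]
      ring
    simp only [JobSystem.uniformStep, Pi.add_apply, Pi.smul_apply, smul_eq_mul, sum_add_distrib,
      ← mul_sum, h3, hp.sum_ball]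
    ring

/-- A policy that never idles has a steady state with finite mean number of jobs. -/
theorem exists_isSteadyState [NeZero K] {S : JobSystem K} (hS : S.IsStable) {P : SchedPolicy K}
    (hP : ∀ n, n ≠ 0 → ∑ i, P.alloc n i = 1) :
    ∃ p, S.IsSteadyState P p ∧ Summable fun n => p n * (groupCount univ n : ℝ) := by
  obtain ⟨p₀, hp₀⟩ := exists_isGeometric (K := K) hS.load_pos.le hS.load_lt_one
  have hL : 0 < ∑ i, S.lam i + S.mu :=
    add_pos (sum_pos (fun i _ => hS.lam_pos i) univ_nonempty) hS.mu_pos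
  have hg : ∀ j, IsGeometric S.load ((S.uniformStep P)^[j] p₀) := fun j => by
    induction j with
    | zero => exact hp₀
    | succ j ih => rw [Function.iterate_succ_apply']; exact ih.uniformStep hS hP
  set a : ℕ → (Fin K → ℕ) → ℝ := fun N =>
    ((N : ℝ) + 1)⁻¹ • ∑ j ∈ range (N + 1), (S.uniformStep P)^[j] p₀ with ha
  have hN : ∀ N : ℕ, (0 : ℝ) < (N : ℝ) + 1 := fun N => by positivity
  have hag : ∀ N, IsGeometric S.load (a N) := fun N => by
    refine ⟨fun n => ?_, fun m => ?_⟩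
    · simp only [ha, Pi.smul_apply, Finset.sum_apply, smul_eq_mul]
      exact mul_nonneg (inv_nonneg.2 (hN N).le) (sum_nonneg fun j _ => (hg j).nonneg n)
    · simp only [ha, Pi.smul_apply, Finset.sum_apply, smul_eq_mul, ← mul_sum]
      rw [sum_comm]
      simp only [(hg _).sum_ball, sum_const, card_range, nsmul_eq_mul]
      have := (hN N).ne'
      push_cast
      field_simp
  have hflow : ∀ n, Tendsto (fun N => S.netflow P (a N) n) atTop (𝓝 0) := fun n => by
    -- The net flow of an iterate is a multiple of its increment, so the net flow of the average
    -- telescopes and is `O(1 / N)`.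
    have h1 : ∀ N, S.netflow P (a N) n = ((N : ℝ) + 1)⁻¹ *
        ((∑ i, S.lam i + S.mu) * ((S.uniformStep P)^[N + 1] p₀ n - p₀ n)) := fun N => by
      have : ∀ q, S.netflow P q = (∑ i, S.lam i + S.mu) • (S.uniformStep P q - q) := fun q => by
        rw [uniformStep, add_sub_cancel_left, smul_smul, mul_inv_cancel₀ hL.ne', one_smul]
      simp only [ha, map_smul, map_sum]
      simp only [this, ← Function.iterate_succ_apply' (S.uniformStep P), ← smul_sum]
      rw [sum_range_sub fun j => (S.uniformStep P)^[j] p₀]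
      simp
    refine squeeze_zero_norm (a := fun N : ℕ => (1 / ((N : ℝ) + 1)) * (∑ i, S.lam i + S.mu))
      (fun N => ?_) ?_
    · rw [h1, norm_mul, norm_mul, Real.norm_of_nonneg (inv_nonneg.2 (hN N).le),
        Real.norm_of_nonneg hL.le, one_div]
      refine mul_le_mul_of_nonneg_left (mul_le_of_le_one_right hL.le ?_) (inv_nonneg.2 (hN N).le)
      have b1 := (hg (N + 1)).nonneg n
      have b2 := (hg (N + 1)).le_one hS.load_pos.le hS.load_lt_one n
      have b3 := hp₀.nonneg n
      have b4 := hp₀.le_one hS.load_pos.le hS.load_lt_one n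
      rw [Real.norm_eq_abs, abs_le]
      constructor <;> linarith
    · simpa using (tendsto_one_div_add_atTop_nhds_zero_nat (𝕜 := ℝ)).mul_const
        (∑ i, S.lam i + S.mu)
  have hK : IsCompact (Set.univ.pi fun _ : Fin K → ℕ => Set.Icc (0 : ℝ) 1) :=
    isCompact_univ_pi fun _ => isCompact_Icc
  -- A limit along an ultrafilter replaces the extraction of a convergent subsequence.
  obtain ⟨p, -, hpU⟩ := hK.ultrafilter_le_nhds ((hyperfilter ℕ).map a) (by
    rw [le_principal_iff]
    exact mem_map.2 (univ_mem' fun N n _ =>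
      ⟨(hag N).nonneg n, (hag N).le_one hS.load_pos.le hS.load_lt_one n⟩))
  have hlim : Tendsto a (hyperfilter ℕ) (𝓝 p) := hpU
  have hle : (hyperfilter ℕ : Filter ℕ) ≤ atTop := by
    rw [← Nat.cofinite_eq_atTop]; exact hyperfilter_le_cofinite
  have hpn : ∀ n, Tendsto (fun N => a N n) (hyperfilter ℕ) (𝓝 (p n)) := tendsto_pi_nhds.1 hlim
  -- The masses of balls are finite sums, so they pass to the pointwise limit; this is the tightness
  -- that makes `p` a probability distribution.
  have hgp : IsGeometric S.load p := by
    refine ⟨fun n => ge_of_tendsto' (hpn n) fun N => (hag N).nonneg n, fun m => ?_⟩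
    have h1 := tendsto_finsetSum (ball K m) fun n _ => hpn n
    simp only [(hag _).sum_ball] at h1
    exact tendsto_nhds_unique h1 tendsto_const_nhds
  refine ⟨p, ⟨hgp.nonneg, hgp.hasSum_one hS.load_pos.le hS.load_lt_one, fun n => ?_⟩,
    hgp.summable_mul_groupCount hS.load_pos.le hS.load_lt_one⟩
  have h1 := ((S.continuous_netflow P n).tendsto p).comp hlim
  have h2 := tendsto_nhds_unique h1 ((hflow n).mono_left hle)
  rw [netflow_apply, sub_eq_zero] at h2
  exact h2.symm
-- The optimal cost and the `cμ`-rule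
/-- The excess of the cost of class `r` over that of the next class. -/
def costGap (S : JobSystem K) (r : Fin K) : ℝ :=
  S.c r - if h : (r : ℕ) + 1 < K then S.c ⟨r + 1, h⟩ else 0

/-- The sum telescopes from class `i` on, the cost after the last class being set to `0`. -/
lemma sum_costGap (S : JobSystem K) (i : Fin K) :
    ∑ r, (if i ≤ r then S.costGap r else 0) = S.c i := by
  set f : ℕ → ℝ := fun j => if h : j < K then S.c ⟨j, h⟩ else 0 with hf
  have h1 : ∀ r : Fin K, S.costGap r = f r - f (r + 1) := fun r => by
    simp [costGap, hf]
  have h2 : ∀ N, (i : ℕ) ≤ N → ∑ j ∈ Ico (i : ℕ) N, (f j - f (j + 1)) = f i - f N := by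
    intro N hN
    induction N, hN using Nat.le_induction with
    | base => simp
    | succ N hN ih => rw [sum_Ico_succ_top hN, ih]; ring
  have h3 : ∑ r, (if i ≤ r then S.costGap r else 0) =
      ∑ j ∈ range K, if (i : ℕ) ≤ j then f j - f (j + 1) else 0 := by
    rw [← Fin.sum_univ_eq_sum_range (fun j => if (i : ℕ) ≤ j then f j - f (j + 1) else 0)]
    exact sum_congr rfl fun r _ => by simp [h1]
  rw [h3, ← sum_filter]
  have h4 : (range K).filter (fun j => (i : ℕ) ≤ j) = Ico (i : ℕ) K := by
    ext j; simp; tauto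
  rw [h4, h2 K i.2.le]
  simp [hf]

lemma costGap_nonneg {S : JobSystem K} (hS : S.IsStable) (hc : Antitone S.c) (r : Fin K) :
    0 ≤ S.costGap r := by
  unfold costGap
  split_ifs with h
  · exact sub_nonneg.2 (hc (Fin.le_def.2 (Nat.le_succ _)))
  · simpa using (hS.c_pos r).le

/-- The cost rate as a combination of the numbers of jobs of the most expensive classes. -/
lemma sum_cost_eq (S : JobSystem K) (n : Fin K → ℕ) :
    ∑ i, S.c i * (n i : ℝ) = ∑ r, S.costGap r * (groupCount (Iic r) n : ℝ) := by
  simp only [← sum_costGap S, sum_mul]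
  rw [sum_comm]
  refine sum_congr rfl fun r _ => ?_
  have : Iic r = univ.filter (· ≤ r) := by ext; simp
  rw [groupCount, this, sum_filter]
  push_cast
  rw [mul_sum]
  refine sum_congr rfl fun i _ => ?_
  split_ifs <;> simp

/-- The load of the class `r` and the more expensive classes. -/
def topLoad (S : JobSystem K) (r : Fin K) : ℝ := ∑ i ∈ Iic r, S.classLoad i

lemma IsStable.topLoad_pos {S : JobSystem K} (hS : S.IsStable) (r : Fin K) : 0 < S.topLoad r :=
  sum_pos (fun i _ => div_pos (hS.lam_pos i) hS.mu_pos) ⟨r, by simp⟩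

lemma IsStable.topLoad_lt_one {S : JobSystem K} (hS : S.IsStable) (r : Fin K) :
    S.topLoad r < 1 :=
  (sum_le_univ_sum_of_nonneg fun i => (div_pos (hS.lam_pos i) hS.mu_pos).le).trans_lt
    hS.load_lt_one

lemma IsStable.sum_lam_Iic {S : JobSystem K} (hS : S.IsStable) (r : Fin K) :
    ∑ i ∈ Iic r, S.lam i = S.mu * S.topLoad r := by
  have := hS.mu_pos.ne'
  simp only [topLoad, classLoad, mul_sum]
  exact sum_congr rfl fun i _ => by field_simp

/-- The cost of the `cμ`-rule. -/
def priorityCost (S : JobSystem K) : ℝ :=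
  ∑ r, S.costGap r * (S.topLoad r / (1 - S.topLoad r))

/-- Under a `cμ`-rule the classes up to `r` have priority if class `r + 1` is cheaper. -/
lemma IsCMuRule.sum_alloc_Iic {S : JobSystem K} {P : SchedPolicy K} (hP : S.IsCMuRule P)
    (hc : Antitone S.c) {r : Fin K} (hr : S.costGap r ≠ 0) {n : Fin K → ℕ}
    (hn : groupCount (Iic r) n ≠ 0) : ∑ i ∈ Iic r, P.alloc n i = 1 := by
  have hex : ∃ i ≤ r, n i ≠ 0 := by
    by_contra! h
    exact hn (groupCount_eq_zero_iff.2 fun i hi => h i (by simpa using hi))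
  obtain ⟨i, hir, hi⟩ := hex
  rw [← hP.1 n (by rintro rfl; simp at hi)]
  refine sum_subset (subset_univ _) fun j _ hj => hP.2 n i j hi ?_
  have hj : r < j := by simpa using hj
  have hlt : (r : ℕ) + 1 < K := (Nat.succ_le_of_lt (Fin.lt_def.1 hj)).trans_lt j.2
  have h1 : S.c ⟨r + 1, hlt⟩ ≤ S.c r := hc (Fin.le_def.2 (Nat.le_succ _))
  have h2 : S.c ⟨r + 1, hlt⟩ ≠ S.c r := fun h => hr (by simp [costGap, hlt, h])
  have h3 : S.c j ≤ S.c ⟨r + 1, hlt⟩ := hc (Fin.le_def.2 (Nat.succ_le_of_lt (Fin.lt_def.1 hj)))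
  exact (h3.trans_lt (lt_of_le_of_ne h1 h2)).trans_le (hc hir)

/-- The cost is the combination of the mean group counts with the nonnegative weights `costGap`, and
each mean obeys the M/M/1 bound. -/
lemma policyCosts_bound {S : JobSystem K} (hS : S.IsStable) (hc : Antitone S.c)
    {P : SchedPolicy K} {C : ℝ} (hC : C ∈ S.policyCosts P) :
    S.priorityCost ≤ C ∧ (S.IsCMuRule P → C = S.priorityCost) := by
  obtain ⟨p, hp, hsum⟩ := hC
  -- Finite cost forces finite mean counts, since every `c i` is positive.
  have h1 : ∀ i, Summable fun n => p n * (n i : ℝ) := fun i => by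
    refine Summable.of_nonneg_of_le (fun n => mul_nonneg (hp.nonneg n) (Nat.cast_nonneg _))
      (fun n => ?_) (hsum.summable.mul_left (S.c i)⁻¹)
    have hci := hS.c_pos i
    have : S.c i * (n i : ℝ) ≤ ∑ i, S.c i * (n i : ℝ) :=
      single_le_sum (f := fun i => S.c i * (n i : ℝ))
        (fun j _ => mul_nonneg (hS.c_pos j).le (Nat.cast_nonneg _)) (mem_univ i)
    calc p n * (n i : ℝ) = (S.c i)⁻¹ * (p n * (S.c i * (n i : ℝ))) := by field_simp
      _ ≤ _ := mul_le_mul_of_nonneg_left (mul_le_mul_of_nonneg_left this (hp.nonneg n))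
        (inv_nonneg.2 hci.le)
  have h2 : ∀ A, Summable fun n => p n * (groupCount A n : ℝ) := fun A => by
    refine (summable_sum (s := A) fun i _ => h1 i).congr fun n => ?_
    simp [groupCount, mul_sum]
  set E : Fin K → ℝ := fun r => ∑' n, p n * (groupCount (Iic r) n : ℝ) with hE
  have h3 : C = ∑ r, S.costGap r * E r := by
    refine hsum.unique ((congrArg (HasSum · _) (funext fun n => ?_)).mpr
      (hasSum_sum fun r (_ : r ∈ univ) => (h2 (Iic r)).hasSum.mul_left (S.costGap r)))
    rw [sum_cost_eq, mul_sum]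
    exact sum_congr rfl fun r _ => by ring
  have h4 := fun r => hp.mean_groupCount hS.mu_pos (Iic r) (h2 (Iic r)).hasSum
  rw [h3, priorityCost]
  have hmu := hS.mu_pos
  refine ⟨sum_le_sum fun r _ => mul_le_mul_of_nonneg_left ?_ (costGap_nonneg hS hc r),
    fun hP => sum_congr rfl fun r _ => ?_⟩
  · have h5 := (h4 r).1
    have h6 := hS.topLoad_lt_one r
    rw [hS.sum_lam_Iic, mul_assoc, mul_le_mul_iff_of_pos_left hmu] at h5
    rw [div_le_iff₀ (by linarith)]
    simp only [hE]
    linarith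
  -- If classes `r` and `r + 1` cost the same, `Iic r` need not have priority and its mean is
  -- undetermined, but its weight is zero.
  · rcases eq_or_ne (S.costGap r) 0 with h0 | h0
    · simp [h0]
    · have h5 := (h4 r).2 fun n hn => hP.sum_alloc_Iic hc h0 hn
      have h6 := hS.topLoad_lt_one r
      rw [hS.sum_lam_Iic, mul_assoc, mul_right_inj' hmu.ne'] at h5
      congr 1
      rw [eq_div_iff (by linarith)]
      simp only [hE]
      linarith

/-- What `policyCosts_bound` leaves open is that some steady state has a finite cost; the cost rate
is at most `c 0` times the total number of jobs. -/
lemma IsCMuRule.policyCosts_eq [NeZero K] {S : JobSystem K} (hS : S.IsStable)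
    (hc : Antitone S.c) {P : SchedPolicy K} (hP : S.IsCMuRule P) :
    S.policyCosts P = {S.priorityCost} := by
  refine Set.eq_singleton_iff_nonempty_unique_mem.2
    ⟨?_, fun C hC => (policyCosts_bound hS hc hC).2 hP⟩
  obtain ⟨p, hp, hs⟩ := exists_isSteadyState hS hP.1
  refine ⟨_, p, hp, Summable.hasSum ?_⟩
  refine Summable.of_nonneg_of_le (fun n => mul_nonneg (hp.nonneg n)
    (sum_nonneg fun i _ => mul_nonneg (hS.c_pos i).le (Nat.cast_nonneg _)))
    (fun n => ?_) (hs.mul_left (S.c 0))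
  have : ∑ i, S.c i * (n i : ℝ) ≤ S.c 0 * (groupCount univ n : ℝ) := by
    rw [groupCount]
    push_cast
    rw [mul_sum]
    exact sum_le_sum fun i _ => mul_le_mul_of_nonneg_right (hc (Fin.zero_le i)) (Nat.cast_nonneg _)
  calc _ ≤ p n * (S.c 0 * (groupCount univ n : ℝ)) :=
        mul_le_mul_of_nonneg_left this (hp.nonneg n)
    _ = _ := by ring

/-- The policy which serves only the first class present. -/
def strictPriority (K : ℕ) : SchedPolicy K where
  alloc n i := if n i ≠ 0 ∧ ∀ j < i, n j = 0 then 1 else 0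
  alloc_nonneg n i := by split_ifs <;> simp
  alloc_sum_le_one n := by
    rw [sum_boole]
    have : ((univ : Finset (Fin K)).filter fun i => n i ≠ 0 ∧ ∀ j < i, n j = 0).card ≤ 1 := by
      refine card_le_one.2 fun a ha b hb => ?_
      simp only [mem_filter, mem_univ, true_and] at ha hb
      rcases lt_trichotomy a b with h | h | h
      · exact absurd (hb.2 a h) ha.1
      · exact h
      · exact absurd (ha.2 b h) hb.1
    exact_mod_cast this
  alloc_empty n i h := by simp [h]

/-- Priority by index refines priority by cost, because a strictly cheaper class has a larger index.
-/
lemma isCMuRule_strictPriority {S : JobSystem K} (hc : Antitone S.c) :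
    S.IsCMuRule (strictPriority K) := by
  refine ⟨fun n hn => ?_, fun n i j hi hij => if_neg fun h => hi (h.2 i ?_)⟩
  · have hne : (univ.filter fun i => n i ≠ 0).Nonempty := by
      obtain ⟨i, hi⟩ := Function.ne_iff.1 hn
      exact ⟨i, by simpa using hi⟩
    refine le_antisymm ((strictPriority K).alloc_sum_le_one n) ?_
    set i := (univ.filter fun i => n i ≠ 0).min' hne with hi
    have h1 : n i ≠ 0 := by simpa using min'_mem _ hne
    have h2 : ∀ j < i, n j = 0 := fun j hj => by
      by_contra h
      exact absurd (min'_le _ j (by simpa using h)) (not_le.2 hj)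
    calc (1 : ℝ) = (strictPriority K).alloc n i := (if_pos ⟨h1, h2⟩).symm
      _ ≤ _ := single_le_sum (fun j _ => (strictPriority K).alloc_nonneg n j) (mem_univ i)
  · by_contra h
    exact absurd (hc (not_lt.1 h)) (not_le.2 hij)

theorem isLeast_priorityCost [NeZero K] {S : JobSystem K} (hS : S.IsStable) (hc : Antitone S.c) :
    IsLeast S.attainableCosts S.priorityCost := by
  refine ⟨⟨strictPriority K, ?_⟩, fun C ⟨P, hC⟩ => (policyCosts_bound hS hc hC).1⟩
  rw [(isCMuRule_strictPriority hc).policyCosts_eq hS hc]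
  rfl

theorem optCost_eq [NeZero K] {S : JobSystem K} (hS : S.IsStable) (hc : Antitone S.c) :
    S.optCost = S.priorityCost :=
  (isLeast_priorityCost hS hc).csInf_eq

/-- The optimal cost exceeds that of a system in which all jobs have the cost of the cheapest
class. -/
lemma lt_priorityCost {k : ℕ} {S : JobSystem (k + 1)} (hS : S.IsStable) (hc : Antitone S.c)
    (hlt : S.c (Fin.last k) < S.c 0) :
    S.c (Fin.last k) * (S.load / (1 - S.load)) < S.priorityCost := by
  have hpos : ∀ r, 0 < S.topLoad r / (1 - S.topLoad r) := fun r =>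
    div_pos (hS.topLoad_pos r) (sub_pos.2 (hS.topLoad_lt_one r))
  have h1 : S.costGap (Fin.last k) = S.c (Fin.last k) := by simp [costGap]
  have h2 : S.topLoad (Fin.last k) = S.load := by
    have : Iic (Fin.last k) = univ := by ext i; simp [Fin.le_last]
    rw [topLoad, this, load]
  -- Otherwise the telescoping sum for `c 0` would be at most its last term, the cost of the last
  -- class.
  have h3 : ∃ r : Fin k, 0 < S.costGap r.castSucc := by
    by_contra! h
    have := sum_costGap S 0
    simp only [Fin.zero_le, if_true] at this
    rw [Fin.sum_univ_castSucc, h1] at this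
    have := sum_nonpos fun r (_ : r ∈ univ) => h r
    linarith
  obtain ⟨r, hr⟩ := h3
  rw [priorityCost, Fin.sum_univ_castSucc, h1, h2, lt_add_iff_pos_left]
  exact sum_pos' (fun i _ => mul_nonneg (costGap_nonneg hS hc _) (hpos _).le)
    ⟨r, mem_univ _, mul_pos hr (hpos _)⟩

end JobSystem

/-! ### The heavy traffic equilibrium and its cost -/

namespace JobSystem

open Finset Filter Topology

/-- The minimisers of `b ↦ A / b + b ^ α` over `b > 0`. -/
lemma isMinOn_div_add_rpow_iff {A α b : ℝ} (hα : 0 < α) (hb : 0 < b) :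
    IsMinOn (fun x : ℝ => A / x + x ^ α) (Set.Ioi 0) b ↔ A = α * b ^ (α + 1) := by
  constructor
  · intro h
    have h1 := h.isLocalMin (Ioi_mem_nhds hb)
    have h2 : HasDerivAt (fun x : ℝ => A / x + x ^ α) (A * (-(b ^ 2)⁻¹) + α * b ^ (α - 1)) b := by
      simp only [div_eq_mul_inv]
      exact ((hasDerivAt_inv hb.ne').const_mul A).add
        (Real.hasDerivAt_rpow_const (Or.inl hb.ne'))
    have h3 := h1.hasDerivAt_eq_zero h2
    have h4 : b ^ (α + 1) = b ^ (α - 1) * b ^ 2 := by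
      rw [← Real.rpow_natCast, ← Real.rpow_add hb]; congr 1; push_cast; ring
    rw [h4]
    field_simp at h3
    linarith
  · rintro rfl x (hx : 0 < x)
    have hu : 0 < x / b := div_pos hx hb
    -- For `u = x / b` the claim becomes `α + 1 ≤ α / u + u ^ α`. It is the sum of `1 + α log u ≤ u
    -- ^ α` and `α` times `1 - log u ≤ 1 / u`; no convexity is needed, so `α < 1` is covered.
    have h1 : 1 + α * Real.log (x / b) ≤ (x / b) ^ α := by
      rw [Real.rpow_def_of_pos hu, mul_comm (Real.log _)]
      linarith [Real.add_one_le_exp (α * Real.log (x / b))]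
    have h2 : 1 - Real.log (x / b) ≤ b / x := by
      have := Real.log_le_sub_one_of_pos (div_pos hb hx)
      rw [← inv_div, Real.log_inv] at this
      rw [inv_div] at this
      linarith
    have h3 : α + 1 ≤ α * (b / x) + (x / b) ^ α := by nlinarith
    have hbα : 0 < b ^ α := Real.rpow_pos_of_pos hb α
    have h4 : x ^ α = b ^ α * (x / b) ^ α := by
      rw [Real.div_rpow hx.le hb.le]; field_simp
    show α * b ^ (α + 1) / b + b ^ α ≤ α * b ^ (α + 1) / x + x ^ α
    rw [h4, Real.rpow_add hb, Real.rpow_one]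
    calc α * (b ^ α * b) / b + b ^ α = b ^ α * (α + 1) := by field_simp
      _ ≤ b ^ α * (α * (b / x) + (x / b) ^ α) := mul_le_mul_of_nonneg_left h3 hbα.le
      _ = _ := by ring

variable {K : ℕ}

/-- The rate-weighted sum of the powers `c i ^ (-1 / (α + 1))`. -/
def invCostSum (S : JobSystem K) (α : ℝ) : ℝ := ∑ i, S.lam i / S.c i ^ (1 / (α + 1))

lemma IsStable.invCostSum_pos [NeZero K] {S : JobSystem K} (hS : S.IsStable) (α : ℝ) :
    0 < S.invCostSum α :=
  sum_pos (fun i _ => div_pos (hS.lam_pos i) (Real.rpow_pos_of_pos (hS.c_pos i) _)) univ_nonempty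

lemma gam_smul (S : JobSystem K) (α t : ℝ) :
    S.gam (fun i => t * S.c i ^ (1 / (α + 1))) = S.invCostSum α / (S.load * S.mu * t) := by
  have : ∀ i, S.classLoad i / (t * S.c i ^ (1 / (α + 1))) =
      S.lam i / S.c i ^ (1 / (α + 1)) * (1 / (S.mu * t)) := fun i => by
    rw [classLoad, div_div, div_mul_div_comm, mul_one]
    congr 1
    ring
  simp only [gam, this, ← sum_mul, invCostSum]
  rw [one_div_mul_eq_div, mul_one_div, div_div]
  congr 1
  ring

/-- At priority levels proportional to `c i ^ (1 / (α + 1))`, the processing times do not depend on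
the factor of proportionality. -/
lemma heavyTrafficTime_smul [NeZero K] {S : JobSystem K} (hS : S.IsStable) {α t : ℝ} (ht : 0 < t)
    (b : ℝ) :
    S.heavyTrafficTime b (fun i => t * S.c i ^ (1 / (α + 1))) =
      S.load / (1 - S.load) * t / S.invCostSum α / b := by
  have h1 := hS.load_pos
  have h2 := hS.invCostSum_pos α
  have h3 := hS.mu_pos
  rw [heavyTrafficTime, gam_smul]
  rcases eq_or_ne b 0 with rfl | hb
  · simp
  have h4 := sub_pos.2 hS.load_lt_one
  field_simp

/-- The factor of proportionality of the equilibrium priority levels. -/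
def hteFactor (S : JobSystem K) (α : ℝ) : ℝ :=
  (S.load / (1 - S.load) / S.invCostSum α / α) ^ (1 / α)

lemma IsStable.hteFactor_pos [NeZero K] {S : JobSystem K} (hS : S.IsStable) {α : ℝ} (hα : 0 < α) :
    0 < S.hteFactor α :=
  Real.rpow_pos_of_pos (div_pos (div_pos (div_pos hS.load_pos (sub_pos.2 hS.load_lt_one))
    (hS.invCostSum_pos α)) hα) _

/-- In the first-order condition `c i` appears once on each side, since `(c i ^ (1 / (α + 1))) ^ (α
+ 1) = c i`. It cancels, so all classes impose the same condition on `t`. -/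
lemma isMinOn_smul_iff [NeZero K] {S : JobSystem K} (hS : S.IsStable) {α t : ℝ} (hα : 0 < α)
    (ht : 0 < t) (i : Fin K) :
    IsMinOn (fun b : ℝ => S.c i *
        S.heavyTrafficTime b (fun i => t * S.c i ^ (1 / (α + 1))) + b ^ α) (Set.Ioi 0)
      (t * S.c i ^ (1 / (α + 1))) ↔ t = S.hteFactor α := by
  have hc := hS.c_pos i
  have hw : 0 < S.c i ^ (1 / (α + 1)) := Real.rpow_pos_of_pos hc _
  have hM : 0 < S.load / (1 - S.load) / S.invCostSum α / α :=
    div_pos (div_pos (div_pos hS.load_pos (sub_pos.2 hS.load_lt_one)) (hS.invCostSum_pos α)) hα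
  have hα1 : α + 1 ≠ 0 := by positivity
  simp only [heavyTrafficTime_smul hS ht, ← mul_div_assoc (S.c i)]
  rw [isMinOn_div_add_rpow_iff hα (mul_pos ht hw), Real.mul_rpow ht.le hw.le, ← Real.rpow_mul hc.le,
    one_div_mul_cancel hα1, Real.rpow_one, Real.rpow_add ht, Real.rpow_one, hteFactor,
    one_div, Real.eq_rpow_inv ht.le hM.le hα.ne', eq_div_iff hα.ne']
  have h1 : S.c i * (S.load / (1 - S.load) * t) / S.invCostSum α =
      (S.c i * t) * (S.load / (1 - S.load) / S.invCostSum α) := by ring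
  have h2 : α * (t ^ α * t * S.c i) = (S.c i * t) * (t ^ α * α) := by ring
  rw [h1, h2, mul_right_inj' (mul_pos hc ht).ne', eq_comm]

/-- The heavy traffic equilibrium. -/
theorem isHTE_iff [NeZero K] {S : JobSystem K} (hS : S.IsStable) {α : ℝ} (hα : 0 < α)
    {β : Fin K → ℝ} :
    S.IsHTE α β ↔ β = fun i => S.hteFactor α * S.c i ^ (1 / (α + 1)) := by
  have hα1 : α + 1 ≠ 0 := by positivity
  constructor
  · intro h
    have hload := hS.load_pos
    have hg : 0 < S.gam β := mul_pos (one_div_pos.2 hload)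
      (sum_pos (fun i _ => div_pos (div_pos (hS.lam_pos i) hS.mu_pos) (h i).1) univ_nonempty)
    -- A single job does not influence `gam β`, so its processing time is `a / b` with the same `a`
    -- for all classes.
    set a : ℝ := 1 / (1 - S.load) * (1 / (S.mu * S.gam β)) with ha
    have ha0 : 0 < a := mul_pos (one_div_pos.2 (sub_pos.2 hS.load_lt_one))
      (one_div_pos.2 (mul_pos hS.mu_pos hg))
    set t : ℝ := (a / α) ^ (1 / (α + 1)) with ht
    have ht0 : 0 < t := Real.rpow_pos_of_pos (div_pos ha0 hα) _
    have hβ : β = fun i => t * S.c i ^ (1 / (α + 1)) := by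
      funext i
      have h1 := (h i).2
      have h2 : ∀ b, S.c i * S.heavyTrafficTime b β = S.c i * a / b := fun b => by
        rw [heavyTrafficTime, ha, mul_right_comm S.mu b, ← div_div 1 (S.mu * S.gam β)]
        ring
      simp only [h2] at h1
      rw [isMinOn_div_add_rpow_iff hα (h i).1] at h1
      rw [ht, ← Real.mul_rpow (div_pos ha0 hα).le (hS.c_pos i).le, one_div,
        Real.eq_rpow_inv (h i).1.le (mul_pos (div_pos ha0 hα) (hS.c_pos i)).le hα1]
      field_simp
      linarith
    -- So far `t` depends on `β` through `gam β`; the condition of any one class now determines it.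
    have h1 := (h 0).2
    rw [hβ, isMinOn_smul_iff hS hα ht0 0] at h1
    rw [hβ, h1]
  · rintro rfl i
    have ht := hS.hteFactor_pos hα
    exact ⟨mul_pos ht (Real.rpow_pos_of_pos (hS.c_pos i) _),
      (isMinOn_smul_iff hS hα ht i).2 rfl⟩

/-- Multiplying numerator and denominator by suitable powers of the data of the last class turns the
terms `+ 1` into its summands and gives the symmetric form in which the equilibrium cost appears. -/
lemma fineBound_eq {k : ℕ} {S : JobSystem (k + 1)} (hS : S.IsStable) {α : ℝ} (hα : 0 < α) :
    S.fineBound α = (∑ i, S.lam i * S.c i / S.c i ^ (1 / (α + 1))) /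
      (S.c (Fin.last k) * S.invCostSum α) := by
  have hα1 : α + 1 ≠ 0 := by positivity
  have hl := hS.lam_pos (Fin.last k)
  have hcl := hS.c_pos (Fin.last k)
  have hw : ∀ i, 0 < S.c i ^ (1 / (α + 1)) := fun i => Real.rpow_pos_of_pos (hS.c_pos i) _
  set v := S.c (Fin.last k) ^ (1 / (α + 1)) with hv
  have hv0 : 0 < v := hw _
  have h1 : ∀ i, (S.c i / S.c (Fin.last k)) ^ (-(1 / (α + 1))) = v / S.c i ^ (1 / (α + 1)) :=
    fun i => by
      rw [Real.rpow_neg (div_pos (hS.c_pos i) hcl).le, Real.div_rpow (hS.c_pos i).le hcl.le,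
        inv_div]
  have h2 : ∀ i, (S.c i / S.c (Fin.last k)) ^ (α / (α + 1)) =
      S.c i / S.c (Fin.last k) * (v / S.c i ^ (1 / (α + 1))) := fun i => by
    have : α / (α + 1) = 1 + -(1 / (α + 1)) := by field_simp; ring
    rw [this, Real.rpow_add (div_pos (hS.c_pos i) hcl), Real.rpow_one, h1]
  have h3 : ∑ i : Fin k, S.lam i.castSucc / S.lam (Fin.last k) *
      (S.c i.castSucc / S.c (Fin.last k)) ^ (α / (α + 1)) + 1 =
      (∑ i, S.lam i * S.c i / S.c i ^ (1 / (α + 1))) *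
        (v / (S.lam (Fin.last k) * S.c (Fin.last k))) := by
    rw [Fin.sum_univ_castSucc, add_mul, sum_mul]
    congr 1
    · refine sum_congr rfl fun i _ => ?_
      rw [h2]; ring
    · rw [← hv]; field_simp
  have h4 : ∑ i : Fin k, S.lam i.castSucc / S.lam (Fin.last k) *
      (S.c i.castSucc / S.c (Fin.last k)) ^ (-(1 / (α + 1))) + 1 =
      S.invCostSum α * (v / S.lam (Fin.last k)) := by
    rw [invCostSum, Fin.sum_univ_castSucc, add_mul, sum_mul]
    congr 1
    · refine sum_congr rfl fun i _ => ?_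
      rw [h1]; ring
    · rw [← hv]; field_simp
  have := hS.invCostSum_pos α
  rw [fineBound, h3, h4]
  field_simp

/-- The processing cost of the heavy traffic equilibrium. -/
theorem IsHTE.processingCost_eq {k : ℕ} {S : JobSystem (k + 1)} (hS : S.IsStable) {α : ℝ}
    (hα : 0 < α) {β : Fin (k + 1) → ℝ} (h : S.IsHTE α β) :
    S.processingCost β =
      S.c (Fin.last k) * (S.load / (1 - S.load)) * S.fineBound α := by
  have hcl := hS.c_pos (Fin.last k)
  have hD := hS.invCostSum_pos α
  have ht := hS.hteFactor_pos hα
  rw [(isHTE_iff hS hα).1 h, processingCost, fineBound_eq hS hα]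
  have h1 : ∀ i, S.lam i * S.c i * S.heavyTrafficTime (S.hteFactor α * S.c i ^ (1 / (α + 1)))
      (fun i => S.hteFactor α * S.c i ^ (1 / (α + 1))) =
      S.lam i * S.c i / S.c i ^ (1 / (α + 1)) * (S.load / (1 - S.load) / S.invCostSum α) :=
    fun i => by
      have := Real.rpow_pos_of_pos (hS.c_pos i) (1 / (α + 1))
      rw [heavyTrafficTime_smul hS ht]
      field_simp
  simp only [h1, ← sum_mul]
  field_simp

end JobSystem

/-! ### Comparison of the two bounds and their tightness -/

namespace JobSystem

open Finset Filter Topology Asymptotics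

lemma fineBound_pos {k : ℕ} {S : JobSystem (k + 1)} (hS : S.IsStable) {α : ℝ} (hα : 0 < α) :
    0 < S.fineBound α := by
  rw [fineBound_eq hS hα]
  refine div_pos (sum_pos (fun i _ => ?_) univ_nonempty)
    (mul_pos (hS.c_pos _) (hS.invCostSum_pos α))
  exact div_pos (mul_pos (hS.lam_pos i) (hS.c_pos i)) (Real.rpow_pos_of_pos (hS.c_pos i) _)

/-- The denominator of the fine bound exceeds `1`, which gives strictness; in the numerator every
cost ratio is at most that of class `0`. -/
lemma fineBound_lt_coarseBound {k : ℕ} (hk : 1 ≤ k) {S : JobSystem (k + 1)} (hS : S.IsStable)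
    (hc : Antitone S.c) {α : ℝ} (hα : 0 < α) : S.fineBound α < S.coarseBound α := by
  have hl := hS.lam_pos (Fin.last k)
  have hcl := hS.c_pos (Fin.last k)
  have hα1 : 0 ≤ α / (α + 1) := by positivity
  have hx : ∀ i, 0 < S.c i / S.c (Fin.last k) := fun i => div_pos (hS.c_pos i) hcl
  have hr : ∀ i, 0 < S.lam i / S.lam (Fin.last k) := fun i => div_pos (hS.lam_pos i) hl
  have : Nonempty (Fin k) := ⟨⟨0, hk⟩⟩
  have h1 : ∑ i : Fin k, S.lam i.castSucc / S.lam (Fin.last k) *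
      (S.c i.castSucc / S.c (Fin.last k)) ^ (α / (α + 1)) ≤
      (∑ i, S.lam i - S.lam (Fin.last k)) / S.lam (Fin.last k) *
    (S.c 0 / S.c (Fin.last k)) ^ (α / (α + 1)) := by
    rw [Fin.sum_univ_castSucc S.lam, add_sub_cancel_right, sum_div, sum_mul]
    refine sum_le_sum fun i _ => mul_le_mul_of_nonneg_left ?_ (hr _).le
    exact Real.rpow_le_rpow (hx _).le (div_le_div_of_nonneg_right (hc (Fin.zero_le _)) hcl.le) hα1
  have h2 : 0 < ∑ i : Fin k, S.lam i.castSucc / S.lam (Fin.last k) *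
      (S.c i.castSucc / S.c (Fin.last k)) ^ (α / (α + 1)) :=
    sum_pos (fun i _ => mul_pos (hr _) (Real.rpow_pos_of_pos (hx _) _)) univ_nonempty
  have h3 : 0 < ∑ i : Fin k, S.lam i.castSucc / S.lam (Fin.last k) *
      (S.c i.castSucc / S.c (Fin.last k)) ^ (-(1 / (α + 1))) :=
    sum_pos (fun i _ => mul_pos (hr _) (Real.rpow_pos_of_pos (hx _) _)) univ_nonempty
  refine (div_lt_self (by linarith) (by linarith)).trans_le ?_
  rw [coarseBound]
  linarith

/-! ### Equal arrival rates and two cost levels -/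

section tight

variable {k : ℕ} {l d m : ℝ}

lemma one_sub_one_div_sq_pos (hm : 1 < m) : 0 < 1 - 1 / m ^ 2 := by
  have : 1 < m ^ 2 := by nlinarith
  rw [sub_pos, div_lt_one (by linarith)]
  exact this

lemma load_ratio_of_sq (hm : 1 < m) : (1 - 1 / m ^ 2) / (1 - (1 - 1 / m ^ 2)) = m ^ 2 - 1 := by
  have : m ≠ 0 := by linarith
  rw [sub_sub_cancel]
  field_simp

lemma tightSystem_classLoad (hl : 0 < l) (i : Fin (k + 1)) :
    (tightSystem k l d m).classLoad i = (1 - 1 / m ^ 2) / (k + 1) := by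
  have : (k : ℝ) + 1 ≠ 0 := by positivity
  simp only [classLoad, tightSystem]
  rw [div_div_eq_mul_div, mul_comm ((k : ℝ) + 1) l, mul_div_mul_left _ _ hl.ne']

lemma tightSystem_load (hl : 0 < l) : (tightSystem k l d m).load = 1 - 1 / m ^ 2 := by
  have : (k : ℝ) + 1 ≠ 0 := by positivity
  simp only [load, tightSystem_classLoad hl, sum_const, card_univ, Fintype.card_fin, nsmul_eq_mul]
  push_cast
  field_simp

lemma tightSystem_isStable (hl : 0 < l) (hd : 0 < d) (hm : 1 < m) :
    (tightSystem k l d m).IsStable where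
  lam_pos _ := hl
  c_pos i := by
    simp only [tightSystem]
    split_ifs
    · exact hd
    · exact mul_pos (by linarith) hd
  mu_pos := div_pos (by positivity) (one_sub_one_div_sq_pos hm)
  load_lt_one := by
    rw [tightSystem_load hl]
    have : 0 < 1 / m ^ 2 := by positivity
    linarith

lemma tightSystem_c_last : (tightSystem k l d m).c (Fin.last k) = d := by simp [tightSystem]

lemma tightSystem_c_castSucc (i : Fin k) : (tightSystem k l d m).c i.castSucc = m * d := by
  simp [tightSystem, (Fin.castSucc_lt_last i).ne]

lemma tightSystem_c_zero (hk : 1 ≤ k) : (tightSystem k l d m).c 0 = m * d := by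
  have : (0 : Fin (k + 1)) ≠ Fin.last k := by
    intro h
    have := congrArg Fin.val h
    simp at this
    omega
  simp [tightSystem, this]

lemma tightSystem_antitone (hd : 0 < d) (hm : 1 < m) : Antitone (tightSystem k l d m).c := by
  intro i j hij
  simp only [tightSystem]
  split_ifs with h1 h2 h2
  · exact le_rfl
  · nlinarith
  · exact absurd (Fin.last_le_iff.1 (h2 ▸ hij)) h1
  · exact le_rfl

/-- The optimal cost exceeds the one forced by the cheapest class by at most a multiple of `m`. -/
lemma tightSystem_priorityCost_le (hl : 0 < l) (hd : 0 < d) (hm : 1 < m) :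
    (tightSystem k l d m).priorityCost ≤ d * (m ^ 2 - 1) + k * (m * d) := by
  have hS := tightSystem_isStable (k := k) hl hd hm
  have hr := one_sub_one_div_sq_pos hm
  have hm2 : 0 < 1 / m ^ 2 := by positivity
  have h1 : (tightSystem k l d m).costGap (Fin.last k) = d := by
    simp [costGap, tightSystem_c_last]
  have h2 : (tightSystem k l d m).topLoad (Fin.last k) = 1 - 1 / m ^ 2 := by
    have : Iic (Fin.last k) = univ := by ext i; simp [Fin.le_last]
    rw [topLoad, this, ← tightSystem_load (k := k) (d := d) hl, load]
  -- Without the last class the load is at most `k / (k + 1)`, away from `1` uniformly in `m`.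
  have h3 : ∀ r : Fin k, (tightSystem k l d m).topLoad r.castSucc /
      (1 - (tightSystem k l d m).topLoad r.castSucc) ≤ k := fun r => by
    have hlt := hS.topLoad_lt_one r.castSucc
    have hk : (0 : ℝ) < k + 1 := by positivity
    have hle : (tightSystem k l d m).topLoad r.castSucc ≤ k / (k + 1) := by
      simp only [topLoad, tightSystem_classLoad hl, sum_const, nsmul_eq_mul, Fin.card_Iic,
        Fin.val_castSucc]
      have hrk : (((r : ℕ) + 1 : ℕ) : ℝ) ≤ k := by exact_mod_cast r.2
      rw [mul_div_assoc', div_le_div_iff_of_pos_right hk]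
      calc _ ≤ (((r : ℕ) + 1 : ℕ) : ℝ) := mul_le_of_le_one_right (by positivity) (by linarith)
        _ ≤ k := hrk
    rw [div_le_iff₀ (by linarith)]
    rw [le_div_iff₀ hk] at hle
    linarith
  have h4 : ∑ r : Fin k, (tightSystem k l d m).costGap r.castSucc ≤ m * d := by
    have := sum_costGap (tightSystem k l d m) 0
    simp only [Fin.zero_le, if_true] at this
    rw [Fin.sum_univ_castSucc, h1] at this
    have h0 : (tightSystem k l d m).c 0 ≤ m * d := by
      simp only [tightSystem]
      split_ifs
      · nlinarith
      · exact le_rfl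
    linarith
  rw [priorityCost, Fin.sum_univ_castSucc, h1, h2, load_ratio_of_sq hm, add_comm]
  gcongr
  calc _ ≤ ∑ r : Fin k, (tightSystem k l d m).costGap r.castSucc * k :=
        sum_le_sum fun r _ => mul_le_mul_of_nonneg_left (h3 r)
          (costGap_nonneg hS (tightSystem_antitone hd hm) _)
    _ ≤ k * (m * d) := by
        rw [← sum_mul, mul_comm]
        exact mul_le_mul_of_nonneg_left h4 (Nat.cast_nonneg _)

lemma tightSystem_coarseBound (hk : 1 ≤ k) (hl : 0 < l) (hd : 0 < d) (α : ℝ) :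
    (tightSystem k l d m).coarseBound α = k * m ^ (α / (α + 1)) + 1 := by
  rw [coarseBound, tightSystem_c_zero hk, tightSystem_c_last, mul_div_cancel_right₀ _ hd.ne']
  simp only [tightSystem, sum_const, card_univ, Fintype.card_fin, nsmul_eq_mul]
  congr 2
  push_cast
  field_simp
  ring

/-- With equal rates and two cost levels the numerators agree, so the bounds differ only by the
denominator, which tends to `1`. -/
lemma tightSystem_fineBound (hk : 1 ≤ k) (hl : 0 < l) (hd : 0 < d) (α : ℝ) :
    (tightSystem k l d m).fineBound α =
      (tightSystem k l d m).coarseBound α / (k * m ^ (-(1 / (α + 1))) + 1) := by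
  rw [tightSystem_coarseBound hk hl hd, fineBound]
  simp only [tightSystem_c_castSucc, tightSystem_c_last, mul_div_cancel_right₀ _ hd.ne']
  simp [tightSystem, div_self hl.ne']

variable {α : ℝ}

/-- The ratio of the optimal cost to the one forced by the cheapest class tends to one. -/
lemma tendsto_tightSystem_cost_div (hk : 1 ≤ k) (hl : 0 < l) (hd : 0 < d) :
    Tendsto (fun m : ℝ => d * (m ^ 2 - 1) / (tightSystem k l d m).optCost) atTop (𝓝 1) := by
  have h0 : Tendsto (fun m : ℝ => m / (m ^ 2 - 1)) atTop (𝓝 0) := by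
    have h1 : Tendsto (fun m : ℝ => 2 / m) atTop (𝓝 0) := tendsto_const_nhds.div_atTop tendsto_id
    refine squeeze_zero' ?_ ?_ h1
    · filter_upwards [eventually_gt_atTop 1] with m hm
      exact div_nonneg (by linarith) (by nlinarith)
    · filter_upwards [eventually_gt_atTop 2] with m hm
      rw [div_le_div_iff₀ (by nlinarith) (by linarith)]
      nlinarith
  have h1 : Tendsto (fun m : ℝ => (tightSystem k l d m).optCost / (d * (m ^ 2 - 1))) atTop
      (𝓝 1) := by
    have h2 : Tendsto (fun m : ℝ => 1 + k * (m / (m ^ 2 - 1))) atTop (𝓝 1) := by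
      simpa using (h0.const_mul (k : ℝ)).const_add 1
    refine tendsto_of_tendsto_of_tendsto_of_le_of_le' tendsto_const_nhds h2 ?_ ?_
    · filter_upwards [eventually_gt_atTop 1] with m hm
      have hS := tightSystem_isStable (k := k) hl hd hm
      have ha := tightSystem_antitone (k := k) (l := l) hd hm
      have hq : 0 < m ^ 2 - 1 := by nlinarith
      have h := lt_priorityCost hS ha (by
        rw [tightSystem_c_last, tightSystem_c_zero hk]; nlinarith)
      rw [tightSystem_load hl, tightSystem_c_last, load_ratio_of_sq hm] at h
      rw [optCost_eq hS ha, le_div_iff₀ (mul_pos hd hq), one_mul]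
      exact h.le
    · filter_upwards [eventually_gt_atTop 1] with m hm
      have hS := tightSystem_isStable (k := k) hl hd hm
      have ha := tightSystem_antitone (k := k) (l := l) hd hm
      have hq : 0 < m ^ 2 - 1 := by nlinarith
      have h := tightSystem_priorityCost_le (k := k) hl hd hm
      rw [optCost_eq hS ha, div_le_iff₀ (mul_pos hd hq)]
      refine h.trans_eq ?_
      field_simp
  have := h1.inv₀ one_ne_zero
  simpa using this

lemma tendsto_fineBound_div_coarseBound (hk : 1 ≤ k) (hl : 0 < l) (hd : 0 < d) (hα : 0 < α) :
    Tendsto (fun m : ℝ => (tightSystem k l d m).fineBound α / (tightSystem k l d m).coarseBound α)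
      atTop (𝓝 1) := by
  have h1 : Tendsto (fun m : ℝ => ((k : ℝ) * m ^ (-(1 / (α + 1))) + 1)⁻¹) atTop (𝓝 1) := by
    have := (((tendsto_rpow_neg_atTop (y := 1 / (α + 1)) (by positivity)).const_mul
      (k : ℝ)).add_const 1).inv₀ (by simp)
    simpa using this
  refine h1.congr' ?_
  filter_upwards [eventually_gt_atTop 1] with m hm
  have : 0 < (tightSystem k l d m).coarseBound α := by
    rw [tightSystem_coarseBound hk hl hd]
    have := Real.rpow_nonneg (zero_le_one.trans hm.le) (α / (α + 1))
    positivity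
  rw [tightSystem_fineBound hk hl hd, div_div_cancel_left' this.ne']

/-- The equilibrium cost is exactly `d * (m ^ 2 - 1)` times the fine bound, so the quotient reduces
to the one in `tendsto_tightSystem_cost_div`. -/
lemma tendsto_tightSystem_anarchy (hk : 1 ≤ k) (hl : 0 < l) (hd : 0 < d) (hα : 0 < α)
    {β : ℝ → Fin (k + 1) → ℝ} (hβ : ∀ m : ℝ, 1 < m → (tightSystem k l d m).IsHTE α (β m)) :
    Tendsto (fun m : ℝ => (tightSystem k l d m).processingCost (β m) /
      (tightSystem k l d m).optCost / (tightSystem k l d m).fineBound α) atTop (𝓝 1) := by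
  refine (tendsto_tightSystem_cost_div hk hl hd).congr' ?_
  filter_upwards [eventually_gt_atTop 1] with m hm
  have hS := tightSystem_isStable (k := k) hl hd hm
  have hf := fineBound_pos hS hα
  rw [(hβ m hm).processingCost_eq hS hα, tightSystem_load hl, tightSystem_c_last, load_ratio_of_sq hm,
    div_right_comm, mul_div_cancel_right₀ _ hf.ne']

lemma tendsto_tightSystem_anarchy_coarse (hk : 1 ≤ k) (hl : 0 < l) (hd : 0 < d) (hα : 0 < α)
    {β : ℝ → Fin (k + 1) → ℝ} (hβ : ∀ m : ℝ, 1 < m → (tightSystem k l d m).IsHTE α (β m)) :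
    Tendsto (fun m : ℝ => (tightSystem k l d m).processingCost (β m) /
      (tightSystem k l d m).optCost / (tightSystem k l d m).coarseBound α) atTop (𝓝 1) := by
  have := (tendsto_tightSystem_anarchy hk hl hd hα hβ).mul
    (tendsto_fineBound_div_coarseBound hk hl hd hα)
  rw [one_mul] at this
  refine this.congr' ?_
  filter_upwards [eventually_gt_atTop 1] with m hm
  have hf := fineBound_pos (tightSystem_isStable (k := k) hl hd hm) hα
  rw [div_mul_div_cancel₀ hf.ne']

/-- The ratio to the coarse bound tends to `1`, hence is eventually at least `1 / 2`. Both the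
divergence and the order of growth follow from this. -/
lemma eventually_le_tightSystem_anarchy (hk : 1 ≤ k) (hl : 0 < l) (hd : 0 < d) (hα : 0 < α)
    {β : ℝ → Fin (k + 1) → ℝ} (hβ : ∀ m : ℝ, 1 < m → (tightSystem k l d m).IsHTE α (β m)) :
    ∀ᶠ m : ℝ in atTop, k * m ^ (α / (α + 1)) ≤ 2 *
      ((tightSystem k l d m).processingCost (β m) / (tightSystem k l d m).optCost) := by
  filter_upwards [eventually_gt_atTop 1, (tendsto_tightSystem_anarchy_coarse hk hl hd hα
    hβ).eventually_const_le (by norm_num : (1 / 2 : ℝ) < 1)] with m hm h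
  have := Real.rpow_nonneg (zero_le_one.trans hm.le) (α / (α + 1))
  rw [tightSystem_coarseBound hk hl hd, le_div_iff₀ (by positivity)] at h
  linarith

end tight

end JobSystem

open JobSystem in
theorem theorem8 (k : ℕ) (hk : 1 ≤ k) (α : ℝ) (hα : 0 < α) :
    -- The bounds, for `K = k + 1 ≥ 2` classes
    (∀ S : JobSystem (k + 1), S.IsStable → Antitone S.c → S.c (Fin.last k) < S.c 0 →
      -- the equilibrium exists and is unique
      (∃! β : Fin (k + 1) → ℝ, S.IsHTE α β) ∧
      -- the optimal cost is a minimum over all policies, attained by the cμ-rule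
      IsLeast S.attainableCosts S.optCost ∧ 0 < S.optCost ∧
      (∃ P : SchedPolicy (k + 1), S.IsCMuRule P) ∧
      (∀ P : SchedPolicy (k + 1), S.IsCMuRule P → S.policyCosts P = {S.optCost}) ∧
      -- the price of anarchy
      (∀ β : Fin (k + 1) → ℝ, S.IsHTE α β →
        S.processingCost β / S.optCost < S.fineBound α) ∧
      S.fineBound α < S.coarseBound α) ∧
    -- The example, as the parameter `m` tends to infinity
    (∀ l d : ℝ, 0 < l → 0 < d →
      (∀ m : ℝ, 1 < m → (JobSystem.tightSystem k l d m).IsStable ∧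
        (JobSystem.tightSystem k l d m).load = 1 - 1 / m ^ 2) ∧
      ∀ β : ℝ → Fin (k + 1) → ℝ,
        (∀ m : ℝ, 1 < m → (JobSystem.tightSystem k l d m).IsHTE α (β m)) →
        -- the price of anarchy is unbounded
        Filter.Tendsto (fun m : ℝ => (JobSystem.tightSystem k l d m).processingCost (β m) /
            (JobSystem.tightSystem k l d m).optCost) Filter.atTop Filter.atTop ∧
        -- at the order `(K - 1) m ^ (α / (α + 1))`
        (fun m : ℝ => (k : ℝ) * m ^ (α / (α + 1))) =O[Filter.atTop]
          (fun m : ℝ => (JobSystem.tightSystem k l d m).processingCost (β m) /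
            (JobSystem.tightSystem k l d m).optCost) ∧
        -- and both bounds are asymptotically tight
        Filter.Tendsto (fun m : ℝ => (JobSystem.tightSystem k l d m).processingCost (β m) /
            (JobSystem.tightSystem k l d m).optCost /
            (JobSystem.tightSystem k l d m).fineBound α) Filter.atTop (nhds 1) ∧
        Filter.Tendsto (fun m : ℝ => (JobSystem.tightSystem k l d m).processingCost (β m) /
            (JobSystem.tightSystem k l d m).optCost /
            (JobSystem.tightSystem k l d m).coarseBound α) Filter.atTop (nhds 1)) := by
  refine ⟨fun S hS hc hlt => ?_, fun l d hl hd => ⟨fun m hm =>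
    ⟨tightSystem_isStable hl hd hm, tightSystem_load hl⟩, fun β hβ => ?_⟩⟩
  · have hload : 0 < S.c (Fin.last k) * (S.load / (1 - S.load)) :=
      mul_pos (hS.c_pos _) (div_pos hS.load_pos (sub_pos.2 hS.load_lt_one))
    have hopt := lt_priorityCost hS hc hlt
    rw [optCost_eq hS hc]
    refine ⟨⟨_, (isHTE_iff hS hα).2 rfl, fun β hβ => (isHTE_iff hS hα).1 hβ⟩,
      isLeast_priorityCost hS hc, hload.trans hopt, ⟨_, isCMuRule_strictPriority hc⟩,
      fun P hP => hP.policyCosts_eq hS hc, fun β hβ => ?_, fineBound_lt_coarseBound hk hS hc hα⟩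
    rw [hβ.processingCost_eq hS hα, div_lt_iff₀ (hload.trans hopt), mul_comm]
    exact mul_lt_mul_of_pos_left hopt (fineBound_pos hS hα)
  · have hle := eventually_le_tightSystem_anarchy hk hl hd hα hβ
    have hk0 : (0 : ℝ) < k := by exact_mod_cast hk
    refine ⟨?_, ?_, tendsto_tightSystem_anarchy hk hl hd hα hβ,
      tendsto_tightSystem_anarchy_coarse hk hl hd hα hβ⟩
    · have h1 : Filter.Tendsto (fun m : ℝ => (k : ℝ) * m ^ (α / (α + 1)) / 2) Filter.atTop
          Filter.atTop :=
        ((tendsto_rpow_atTop (by positivity)).const_mul_atTop hk0).atTop_div_const two_pos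
      refine Filter.tendsto_atTop_mono' _ ?_ h1
      filter_upwards [hle] with m hm
      linarith
    · refine Asymptotics.IsBigO.of_bound 2 ?_
      filter_upwards [hle, Filter.eventually_gt_atTop 1] with m hm hm1
      have h0 : 0 ≤ (k : ℝ) * m ^ (α / (α + 1)) :=
        mul_nonneg hk0.le (Real.rpow_nonneg (zero_le_one.trans hm1.le) _)
      rw [Real.norm_of_nonneg h0]
      exact hm.trans (mul_le_mul_of_nonneg_left (le_abs_self _) two_pos.le)

end
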